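/- Consider oriented site percolation on the triangular lattice, realised on $\mathbb{Z}^2$ as follows: each site is independently occupied with probability $p\in[0,1]$ and vacant with probability $1-p$; an occupied site $x$ has directed edges to $x+(-1,0)$, $x+(0,1)$ and $x+(-1,1)$, and a vacant site has no outgoing edges. Let $\mathbf{C}_o$ be the forward cluster of the origin $o$, i.e. the set of sites $y$ that can be reached from $o$ by a finite (possibly trivial) directed path. Let $\Theta_+(p)=\mathbb{P}_p(|\mathbf{C}_o|=\infty)$ and $p_c=\inf\{p\in[0,1]:\Theta_+(p)>0\}$, and for $n\ge 0$ let $$w_n=\sup\{x\in\mathbb{Z}:(-n,x)\in\mathbf{C}_o\},\qquad v_n=\inf\{x\in\mathbb{Z}:(-n,x)\in\mathbf{C}_o\}$$ (in the extended reals). Then for every $p$ with $p_c<p<1$ there exists a real number $\rho=\rho_p<-1$ such that, $\mathbb{P}_p$-almost surely on the event $\{|\mathbf{C}_o|=\infty\}$, the upper and lower boundaries of $\mathbf{C}_o$ have asymptotic slopes $\rho$ and $1/\rho$ respectively, that is, $$\frac{w_n}{-n}\to\rho\qquad\text{and}\qquad\frac{v_n}{-n}\to\frac1\rho\qquad\text{as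 } n\to\infty.$$ -/

import Mathlib

open MeasureTheory ProbabilityTheory Filter Topology

namespace OTSP

/-- The three steps available at an occupied site: west, north and north-west. (Joining each site
of `ℤ × ℤ` to its nearest neighbours and along these diagonals gives the triangular lattice.) -/
def steps : Set (ℤ × ℤ) := {(-1, 0), (0, 1), (-1, 1)}

/-- A configuration: `ω x = true` when the site `x` is occupied. -/
abbrev Config : Type := ℤ × ℤ → Bool

/-- The local environment at `x`: all three steps if `x` is occupied, none otherwise. -/
def localEnv (ω : Config) (x : ℤ × ℤ) : Set (ℤ × ℤ) := {e | ω x = true ∧ e ∈ steps}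

/-- `x → y`: there is a finite sequence (possibly of length `0`) from `x` to `y`, each of whose
increments belongs to the local environment of the site it leaves. -/
def Connected (ω : Config) : ℤ × ℤ → ℤ × ℤ → Prop :=
  Relation.ReflTransGen fun a b => b - a ∈ localEnv ω a

/-- The forward cluster of `x`. -/
def forwardCluster (ω : Config) (x : ℤ × ℤ) : Set (ℤ × ℤ) := {y | Connected ω x y}

/-- The law of the configuration: the sites are independently occupied with probability `p`. -/
noncomputable def law (p : unitInterval) : Measure Config :=
  Measure.infinitePi fun _ : ℤ × ℤ => bernoulliMeasure true false p

/-- The probability that the forward cluster of the origin is infinite. -/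
noncomputable def percProb (p : unitInterval) : ENNReal :=
  law p {ω | (forwardCluster ω 0).Infinite}

/-- The critical value, as an infimum in the complete lattice `[0, 1]`. -/
noncomputable def criticalValue : unitInterval := sInf {p | 0 < percProb p}

/-- `w_n = sup {x : (-n, x) ∈ C_o}`, in the extended reals. -/
noncomputable def upper (ω : Config) (n : ℕ) : EReal :=
  ⨆ x ∈ {x : ℤ | (-(n : ℤ), x) ∈ forwardCluster ω 0}, ((x : ℝ) : EReal)

/-- `v_n = inf {x : (-n, x) ∈ C_o}`, in the extended reals. -/
noncomputable def lower (ω : Config) (n : ℕ) : EReal :=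
  ⨅ x ∈ {x : ℤ | (-(n : ℤ), x) ∈ forwardCluster ω 0}, ((x : ℝ) : EReal)

end OTSP

namespace OTSP

/-! Read the cluster column by column, from right to left. Let `top ω n` be the highest entry point
into column `n` of paths started from the half-line of heights at most 0. By planarity
(`Covers.nextEntry`), if the origin reaches column `n` then it reaches this very point, so on
survival the upper boundary is `top`, up to a vertical run of negligible length.

Existence of the slope is a regeneration argument. Call `k` a regeneration if the highest entry
point into column `k` reaches every later column. Given a later regeneration, being one is decided
by the columns in between (`Good.ren_iff_nonempty`), so under the law conditioned on survival the
pairs (gap, rise) between successive regenerations are i.i.d. (`regen_spec`, `strong_law_iterate`).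
The mean gap is finite because the events "the last regeneration before column `n` is at `j`" are
disjoint (`tsum_noRen_le_one`). The mean rise is finite because `top` grows at most like a sum of
i.i.d. geometric runs. The strong law then gives the slope `l`, the mean rise divided by the mean
gap (`exists_slope`).

The reflection `flip` exchanges west and north, so the rightmost points of the rows also grow at
rate `l`. Inverting this gives the growth rate `1 / l` for the lowest points of the columns
(`boundary_slopes`). Since the lower boundary lies below the upper one, `1 ≤ l * l`, hence `1 ≤ l`
wherever percolation occurs (`one_le_slope`).

Strictness comes from comparing `p` with a percolating density `q < p`. In a coupling by uniform
labels, the density is raised from `q` to `p` one column at a time, and each column adds at least `p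
- q` to the mean height (`meanTop_add_le`). Mean heights are compared with slopes from both sides:
`l * k ≤ meanTop k` by subadditivity (`slope_mul_le_meanTop`), and `meanTop n / n ≤ l + o(1)` by the
independence of past and future (`exists_meanTop_div_le`). Hence the slope at `p` is at least `1 +
(p - q)`, and `ρ` is minus that slope. -/

/-- Environments indexed by column `n : ℕ` and height `y : ℤ`. -/
abbrev Env (S : Type*) : Type _ := ℕ × ℤ → S

/-- The environment seen from the site `(k, y)`. -/
def shift {S : Type*} (k : ℕ) (y : ℤ) (ω : Env S) : Env S := fun i => ω (i.1 + k, i.2 + y)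

/-- The heights at which the next column is entered, when the current column has occupation `ξ` and
is itself entered at the heights in `E`. -/
def nextEntry (ξ : ℤ → Bool) (E : Set ℤ) : Set ℤ :=
  {z | ∃ e ∈ E, ∃ y, e ≤ y ∧ (∀ u, e ≤ u → u ≤ y → ξ u = true) ∧ (z = y ∨ z = y + 1)}

/-- The heights at which column `n` is entered by paths entering column `0` in `A`. -/
def entry (ω : Env Bool) (A : Set ℤ) : ℕ → Set ℤ
  | 0 => A
  | n + 1 => nextEntry (fun y => ω (n, y)) (entry ω A n)

/-! ### Deterministic path properties: planarity, subadditivity, regeneration. -/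

section Deterministic

variable {S : Type*} {ω ω' : Env Bool} {A B : Set ℤ} {n k : ℕ} {y : ℤ}

@[simp] lemma entry_zero : entry ω A 0 = A := rfl

lemma entry_succ : entry ω A (n + 1) = nextEntry (fun y => ω (n, y)) (entry ω A n) := rfl

lemma shift_shift (j k : ℕ) (x y : ℤ) (ω : Env S) :
    shift j x (shift k y ω) = shift (k + j) (y + x) ω := by
  funext i
  simp only [shift]
  congr 2 <;> ring

@[simp] lemma shift_zero (ω : Env S) : shift 0 0 ω = ω := by
  funext i; simp [shift]

lemma nextEntry_mono {ξ ξ' : ℤ → Bool} (hξ : ∀ y, ξ y = true → ξ' y = true) (h : A ⊆ B) :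
    nextEntry ξ A ⊆ nextEntry ξ' B := by
  rintro z ⟨e, he, y, hy, hr, hz⟩
  exact ⟨e, h he, y, hy, fun u h1 h2 => hξ u (hr u h1 h2), hz⟩

lemma entry_mono_env (hω : ∀ i, ω i = true → ω' i = true) (h : A ⊆ B) (n : ℕ) :
    entry ω A n ⊆ entry ω' B n := by
  induction n with
  | zero => exact h
  | succ n ih => exact nextEntry_mono (fun y => hω (n, y)) ih

lemma entry_mono (h : A ⊆ B) (n : ℕ) : entry ω A n ⊆ entry ω B n :=
  entry_mono_env (fun _ => id) h n

lemma nextEntry_union (ξ : ℤ → Bool) (A B : Set ℤ) :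
    nextEntry ξ (A ∪ B) = nextEntry ξ A ∪ nextEntry ξ B := by
  apply Set.Subset.antisymm
  · rintro z ⟨e, he | he, h⟩
    · exact Or.inl ⟨e, he, h⟩
    · exact Or.inr ⟨e, he, h⟩
  · exact Set.union_subset (nextEntry_mono (fun _ => id) Set.subset_union_left)
      (nextEntry_mono (fun _ => id) Set.subset_union_right)

lemma entry_union (A B : Set ℤ) (n : ℕ) : entry ω (A ∪ B) n = entry ω A n ∪ entry ω B n := by
  induction n with
  | zero => rfl
  | succ n ih => rw [entry_succ, ih, nextEntry_union]; rfl

lemma nextEntry_empty (ξ : ℤ → Bool) : nextEntry ξ ∅ = ∅ := by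
  ext z; simp [nextEntry]

lemma entry_congr (h : ∀ i : ℕ × ℤ, i.1 < n → ω i = ω' i) : entry ω A n = entry ω' A n := by
  induction n with
  | zero => rfl
  | succ n ih =>
    rw [entry_succ, entry_succ, ih fun i hi => h i (hi.trans n.lt_succ_self)]
    congr 1
    funext y
    exact h (n, y) n.lt_succ_self

lemma entry_add (ω : Env Bool) (A : Set ℤ) (k n : ℕ) :
    entry ω A (k + n) = entry (shift k 0 ω) (entry ω A k) n := by
  induction n with
  | zero => rfl
  | succ n ih =>
    rw [← add_assoc, entry_succ, ih, entry_succ]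
    congr 1
    funext y
    simp [shift, add_comm]

lemma nextEntry_translate (ξ : ℤ → Bool) (B : Set ℤ) (y : ℤ) :
    nextEntry (fun u => ξ (u + y)) {a | a + y ∈ B} = {z | z + y ∈ nextEntry ξ B} := by
  ext z
  constructor
  · rintro ⟨e, he, x, hx, hr, hz⟩
    refine ⟨e + y, he, x + y, by lia, fun u h1 h2 => ?_, by lia⟩
    simpa using hr (u - y) (by lia) (by lia)
  · rintro ⟨e, he, x, hx, hr, hz⟩
    refine ⟨e - y, by simpa using he, x - y, by lia, fun u h1 h2 => ?_, by lia⟩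
    exact hr (u + y) (by lia) (by lia)

lemma entry_shift (ω : Env Bool) (B : Set ℤ) (k : ℕ) (y : ℤ) (n : ℕ) :
    entry (shift k y ω) {a | a + y ∈ B} n = {z | z + y ∈ entry (shift k 0 ω) B n} := by
  induction n with
  | zero => rfl
  | succ n ih =>
    rw [entry_succ, ih, entry_succ, ← nextEntry_translate]
    congr 1
    funext u
    simp [shift]

lemma mem_entry_shift_singleton {z : ℤ} :
    z ∈ entry (shift k y ω) {0} n ↔ z + y ∈ entry (shift k 0 ω) {y} n := by
  have h := entry_shift ω {y} k y n
  have : {a : ℤ | a + y ∈ ({y} : Set ℤ)} = {0} := by ext; simp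
  rw [this] at h
  rw [h]; rfl

lemma mem_entry_shift_Iic {z : ℤ} :
    z ∈ entry (shift k y ω) (Set.Iic 0) n ↔ z + y ∈ entry (shift k 0 ω) (Set.Iic y) n := by
  have h := entry_shift ω (Set.Iic y) k y n
  have : {a : ℤ | a + y ∈ Set.Iic y} = Set.Iic 0 := by ext; simp
  rw [this] at h
  rw [h]; rfl

/-- Every point of `A` lying above some point of `B` belongs to `B`. -/
def Covers (A B : Set ℤ) : Prop := ∀ z ∈ A, ∀ z' ∈ B, z' ≤ z → z ∈ B

/-- Planarity: a path that starts below and ends above another path meets it. -/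
lemma Covers.nextEntry {A B : Set ℤ} (h : Covers A B) (ξ : ℤ → Bool) :
    Covers (nextEntry ξ A) (nextEntry ξ B) := by
  rintro z ⟨e, he, y, hy, hr, hz⟩ z' ⟨e', he', y', hy', hr', hz'⟩ hle
  by_cases hee : e' ≤ e
  · exact ⟨e, h e he e' he' hee, y, hy, hr, hz⟩
  -- The run climbing from `e` passes through `e'`, so from `e'` the rest of it can be followed.
  by_cases hye : e' ≤ y
  · exact ⟨e', he', y, hye, fun u h1 h2 => hr u (by lia) h2, hz⟩
  -- Here `z ≤ y + 1 ≤ e' ≤ z' ≤ z`.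
  · have : z = z' := by lia
    subst this
    exact ⟨e', he', y', hy', hr', hz'⟩

lemma Covers.entry {A B : Set ℤ} (h : Covers A B) (ω : Env Bool) (n : ℕ) :
    Covers (entry ω A n) (entry ω B n) := by
  induction n with
  | zero => exact h
  | succ n ih => exact ih.nextEntry _

lemma covers_Iic_singleton (y : ℤ) : Covers (Set.Iic y) {y} := by
  rintro z hz z' rfl h
  exact le_antisymm hz h

lemma exists_le_of_mem_entry {z : ℤ} (h : z ∈ entry ω A n) : ∃ a ∈ A, a ≤ z := by
  induction n generalizing z with
  | zero => exact ⟨z, h, le_rfl⟩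
  | succ n ih =>
    obtain ⟨e, he, y, hy, -, hz⟩ := h
    obtain ⟨a, ha, hae⟩ := ih he
    exact ⟨a, ha, by lia⟩

/-- Each column has vacant sites arbitrarily high up, and arbitrarily low down there are rows
occupied along any given number of columns. -/
def Good (ω : Env Bool) : Prop :=
  ∀ n : ℕ, ∀ b : ℤ, (∃ y, b ≤ y ∧ ω (n, y) = false) ∧ ∃ y ≤ b, ∀ i < n, ω (i, y) = true

lemma Good.shifted (h : Good ω) (k : ℕ) (y : ℤ) : Good (shift k y ω) := by
  intro n b
  obtain ⟨⟨u, hu, hv⟩, -⟩ := h (n + k) (b + y)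
  obtain ⟨-, ⟨u', hu', hv'⟩⟩ := h (n + k) (b + y)
  refine ⟨⟨u - y, by lia, by simpa [shift] using hv⟩, u' - y, by lia, fun i hi => ?_⟩
  simpa [shift] using hv' (i + k) (by lia)

lemma bddAbove_nextEntry {ξ : ℤ → Bool} (h : ∀ b, ∃ y, b ≤ y ∧ ξ y = false) (hA : BddAbove A) :
    BddAbove (nextEntry ξ A) := by
  obtain ⟨b, hb⟩ := hA
  obtain ⟨v, hv, hξ⟩ := h b
  refine ⟨v, ?_⟩
  rintro z ⟨e, he, y, hy, hr, hz⟩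
  by_contra hlt
  have := hr v ((hb he).trans hv) (by lia)
  simp [hξ] at this

lemma Good.bddAbove_entry (h : Good ω) (hA : BddAbove A) (n : ℕ) : BddAbove (entry ω A n) := by
  induction n with
  | zero => exact hA
  | succ n ih => exact bddAbove_nextEntry (fun b => (h n b).1) ih

lemma mem_entry_of_row (hy : y ∈ A) (h : ∀ i < n, ω (i, y) = true) : y ∈ entry ω A n := by
  induction n with
  | zero => exact hy
  | succ n ih =>
    refine ⟨y, ih fun i hi => h i (hi.trans n.lt_succ_self), y, le_rfl, fun u h1 h2 => ?_, Or.inl rfl⟩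
    rw [le_antisymm h2 h1]
    exact h n n.lt_succ_self

/-- The highest entry point into column `n` of the paths started from `{(0, y) : y ≤ 0}`. -/
noncomputable def top (ω : Env Bool) (n : ℕ) : ℤ := sSup (entry ω (Set.Iic 0) n)

/-- The origin reaches every column. -/
def Surv (ω : Env Bool) : Prop := ∀ n, (entry ω {0} n).Nonempty

/-- The highest entry point into column `k` reaches every later column. -/
def Ren (ω : Env Bool) (k : ℕ) : Prop := Surv (shift k (top ω k) ω)

@[simp] lemma top_zero (ω : Env Bool) : top ω 0 = 0 := by
  simp [top]

lemma ren_zero : Ren ω 0 ↔ Surv ω := by simp [Ren]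

/-- An occupied row below height 0 makes the entry set nonempty and vacant sites bound it above, so
the supremum defining `top` is attained and is not a default value. -/
lemma Good.isGreatest_entry_Iic (h : Good ω) (n : ℕ) :
    IsGreatest (entry ω (Set.Iic 0) n) (top ω n) := by
  obtain ⟨y, hy, hr⟩ := (h n 0).2
  have hne : (entry ω (Set.Iic 0) n).Nonempty := ⟨y, mem_entry_of_row hy hr⟩
  have hb := h.bddAbove_entry (A := Set.Iic 0) bddAbove_Iic n
  exact ⟨Int.csSup_mem hne hb, fun z hz => le_csSup hb hz⟩

lemma top_congr (h : ∀ i : ℕ × ℤ, i.1 < n → ω i = ω' i) : top ω n = top ω' n := by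
  rw [top, top, entry_congr h]

/-- If the origin reaches column `n` then the highest entry point there is reached from it. -/
lemma Good.top_mem_of_nonempty (h : Good ω) (hne : (entry ω {0} n).Nonempty) :
    top ω n ∈ entry ω {0} n := by
  obtain ⟨z, hz⟩ := hne
  have hg := h.isGreatest_entry_Iic n
  exact (covers_Iic_singleton 0).entry ω n _ hg.1 z hz
    (hg.2 (entry_mono (by simp) n hz))

lemma Good.top_nonneg (h : Good ω) (hne : (entry ω {0} n).Nonempty) : 0 ≤ top ω n := by
  obtain ⟨a, rfl, h⟩ := exists_le_of_mem_entry (h.top_mem_of_nonempty hne)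
  exact h

/-- Enlarging the entry set of column `k` to the whole half-line below `b` only adds paths. The
bound `b` is left free for `stepGain_le`, where it is one less than the top of another environment.
-/
lemma Good.top_add_le_of_le (h : Good ω) {b : ℤ} (hb : top ω k ≤ b) (n : ℕ) :
    top ω (k + n) ≤ b + top (shift k b ω) n := by
  have h1 := (h.isGreatest_entry_Iic (k + n)).1
  rw [entry_add] at h1
  have h2 := entry_mono (ω := shift k 0 ω) (fun z hz => ((h.isGreatest_entry_Iic k).2 hz).trans hb :
    entry ω (Set.Iic 0) k ⊆ Set.Iic b) n h1
  have h3 : top ω (k + n) - b ∈ entry (shift k b ω) (Set.Iic 0) n :=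
    mem_entry_shift_Iic.2 (by rw [sub_add_cancel]; exact h2)
  have := ((h.shifted k b).isGreatest_entry_Iic n).2 h3
  lia

lemma Good.top_add_le (h : Good ω) (k n : ℕ) :
    top ω (k + n) ≤ top ω k + top (shift k (top ω k) ω) n :=
  h.top_add_le_of_le le_rfl n

/-- Subadditivity becomes equality once the top of column `k` itself reaches column `k + n`: by
planarity it then attains the highest point reachable from the half-line below it. -/
lemma Good.top_add (h : Good ω) {k n : ℕ}
    (hne : (entry (shift k (top ω k) ω) {0} n).Nonempty) :
    top ω (k + n) = top ω k + top (shift k (top ω k) ω) n := by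
  refine le_antisymm (h.top_add_le k n) ?_
  have h1 := (h.shifted k (top ω k)).top_mem_of_nonempty hne
  rw [mem_entry_shift_singleton] at h1
  have h2 : top (shift k (top ω k) ω) n + top ω k ∈ entry ω (Set.Iic 0) (k + n) := by
    rw [entry_add]
    exact entry_mono (by simpa using (h.isGreatest_entry_Iic k).1) n h1
  have := (h.isGreatest_entry_Iic (k + n)).2 h2
  lia

lemma Good.ren_add (h : Good ω) {k : ℕ} (hk : Ren ω k) (n : ℕ) :
    Ren ω (k + n) ↔ Ren (shift k (top ω k) ω) n := by
  rw [Ren, Ren, shift_shift, h.top_add (hk n)]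

/-- Extending a path to an entry point that reaches every later column. -/
lemma nonempty_of_mem_of_surv {x : ℤ} (hx : x ∈ entry ω A k) (hs : Surv (shift k x ω)) (n : ℕ) :
    (entry ω A (k + n)).Nonempty := by
  obtain ⟨z, hz⟩ := hs n
  rw [mem_entry_shift_singleton] at hz
  refine ⟨z + x, ?_⟩
  rw [entry_add]
  exact entry_mono (by simpa using hx) n hz

lemma nonempty_of_le (hkn : k ≤ n) (h : (entry ω A n).Nonempty) : (entry ω A k).Nonempty := by
  by_contra hk
  rw [Set.not_nonempty_iff_eq_empty] at hk
  obtain ⟨m, rfl⟩ := Nat.exists_eq_add_of_le hkn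
  rw [entry_add, hk] at h
  have : ∀ (ω : Env Bool) m, entry ω ∅ m = ∅ := by
    intro ω m
    induction m with
    | zero => rfl
    | succ m ih => rw [entry_succ, ih, nextEntry_empty]
  simp [this] at h

/-- If the top of column `j` reaches column `j + n` at all, it reaches the top there, which
survives. An event about the infinite future thus becomes one about finitely many columns. -/
lemma Good.ren_iff_nonempty (h : Good ω) {j n : ℕ} (hr : Ren ω (j + n)) :
    Ren ω j ↔ (entry (shift j (top ω j) ω) {0} n).Nonempty := by
  refine ⟨fun hj => hj n, fun hne m => ?_⟩
  have h1 := (h.shifted j (top ω j)).top_mem_of_nonempty hne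
  have h2 : Surv (shift n (top (shift j (top ω j) ω) n) (shift j (top ω j) ω)) := by
    rw [shift_shift, ← h.top_add hne]
    exact hr
  exact nonempty_of_le (Nat.le_add_left m n) (nonempty_of_mem_of_surv h1 h2 m)

/-- The number of consecutive occupied sites in column `0`, starting from height `0` upwards. -/
noncomputable def run (ω : Env Bool) : ℕ := sInf {k : ℕ | ω (0, (k : ℤ)) = false}

/-- The number of consecutive occupied sites above the highest entry point into column `n`. -/
noncomputable def topRun (ω : Env Bool) (n : ℕ) : ℕ := run (shift n (top ω n) ω)

lemma Good.run_spec (h : Good ω) : ω (0, (run ω : ℤ)) = false := by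
  obtain ⟨⟨y, hy, hv⟩, -⟩ := h 0 0
  have : {k : ℕ | ω (0, (k : ℤ)) = false}.Nonempty := ⟨y.toNat, by simpa [Int.toNat_of_nonneg hy]⟩
  exact Nat.sInf_mem this

lemma eq_true_of_lt_run {k : ℕ} (hk : k < run ω) : ω (0, (k : ℤ)) = true := by
  have := Nat.notMem_of_lt_sInf hk
  simpa using this

lemma Good.topRun_spec (h : Good ω) (n : ℕ) : ω (n, top ω n + topRun ω n) = false := by
  have := (h.shifted n (top ω n)).run_spec
  simpa [shift, topRun, add_comm] using this

lemma Good.top_succ_le (h : Good ω) (n : ℕ) : top ω (n + 1) ≤ top ω n + topRun ω n := by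
  obtain ⟨e, he, y, hy, hr, hz⟩ := (h.isGreatest_entry_Iic (n + 1)).1
  have h1 := (h.isGreatest_entry_Iic n).2 he
  by_contra hlt
  have := hr (top ω n + topRun ω n) (by lia) (by lia)
  simp [h.topRun_spec] at this

/-- The total length of the runs above the highest entry points. -/
noncomputable def runSum (ω : Env Bool) (n : ℕ) : ℕ := ∑ j ∈ Finset.range n, topRun ω j

/-- Each increment of `top` is at most the run above it. This gives a one-sided control between
regenerations by a sum to which the strong law applies. -/
lemma Good.top_le_add_runSum (h : Good ω) {m n : ℕ} (hmn : m ≤ n) :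
    top ω n + runSum ω m ≤ top ω m + runSum ω n := by
  induction n, hmn using Nat.le_induction with
  | base => exact le_rfl
  | succ n _ ih =>
    have := h.top_succ_le n
    have h2 : runSum ω (n + 1) = runSum ω n + topRun ω n := Finset.sum_range_succ _ _
    push_cast [h2]
    lia

end Deterministic

/-! ### Independence of columns and restarting at a random height. -/

lemma measure_eq_tsum_inter_fiber {Ω α : Type*} [MeasurableSpace Ω] [Countable α]
    [MeasurableSpace α] [MeasurableSingletonClass α] (μ : Measure Ω) {F : Ω → α}
    (hF : Measurable F) (E : Set Ω) : μ E = ∑' a, μ (E ∩ F ⁻¹' {a}) := by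
  have h := tsum_measure_preimage_singleton (μ := μ.restrict E) (Set.countable_univ)
    (f := F) fun a _ => hF (measurableSet_singleton a)
  rw [Set.preimage_univ, Measure.restrict_apply_univ] at h
  rw [← h, tsum_univ (f := fun a => μ.restrict E (F ⁻¹' {a}))]
  refine tsum_congr fun a => ?_
  rw [Measure.restrict_apply (hF (measurableSet_singleton a)), Set.inter_comm]

section Restart

variable {S β : Type*}

/-- The sites in the first `k` columns. -/
def before (k : ℕ) : Set (ℕ × ℤ) := {i | i.1 < k}

lemma before_mono {k l : ℕ} (h : k ≤ l) : before k ⊆ before l := fun _ hi => lt_of_lt_of_le hi h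

lemma dependsOn_comp_shift {f : Env S → β} {j k : ℕ} (hf : DependsOn f (before k))
    {N : Env S → ℤ} (hN : DependsOn N (before j)) :
    DependsOn (fun ω => f (shift j (N ω) ω)) (before (j + k)) := by
  intro ω ω' h
  have hNe : N ω = N ω' := hN fun i hi => h i (before_mono (Nat.le_add_right j k) hi)
  simp only [hNe]
  refine hf fun i hi => h _ ?_
  simp only [before, Set.mem_ofPred_eq] at hi ⊢
  lia

variable [MeasurableSpace S] [MeasurableSpace β]

@[fun_prop]
lemma measurable_shift (k : ℕ) (y : ℤ) : Measurable (shift (S := S) k y) :=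
  measurable_pi_lambda _ fun _ => measurable_pi_apply _

lemma measurable_shift_random (k : Env S → ℕ) (hk : Measurable k) (N : Env S → ℤ)
    (hN : Measurable N) : Measurable fun ω => shift (k ω) (N ω) ω := by
  have h : Measurable fun x : (ℕ × ℤ) × Env S => shift x.1.1 x.1.2 x.2 :=
    measurable_from_prod_countable_right fun c => measurable_shift c.1 c.2
  exact h.comp ((hk.prodMk hN).prodMk measurable_id)

variable (ν : Measure S) [IsProbabilityMeasure ν]

/-- The law of an environment whose sites are independent with law `ν`. -/
noncomputable def envLaw : Measure (Env S) := Measure.infinitePi fun _ : ℕ × ℤ => ν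

instance : IsProbabilityMeasure (envLaw ν) := by unfold envLaw; infer_instance

lemma measurePreserving_shift (k : ℕ) (y : ℤ) :
    MeasurePreserving (shift k y) (envLaw ν) (envLaw ν) := by
  refine ⟨measurable_shift k y, ?_⟩
  have hinj : Function.Injective fun i : ℕ × ℤ => (i.1 + k, i.2 + y) := by
    rintro ⟨a, b⟩ ⟨c, d⟩ h
    simpa using h
  exact Measure.map_infinitePi_infinitePi_of_inj (P := fun _ : ℕ × ℤ => ν) hinj

lemma measure_inter_shift {k : ℕ} {D C : Set (Env S)} (hD : MeasurableSet D)
    (hDk : DependsOn (· ∈ D) (before k)) (hC : MeasurableSet C) (y : ℤ) :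
    envLaw ν (D ∩ shift k y ⁻¹' C) = envLaw ν D * envLaw ν C := by
  obtain ⟨s₀⟩ : Nonempty S := nonempty_of_isProbabilityMeasure ν
  -- Overwriting all later columns by a constant does not affect membership in `D`, and shows that
  -- `D` lies in the σ-algebra of the first `k` columns.
  let freeze : Env S → Env S := fun ω i => if i.1 < k then ω i else s₀
  have hDf : D = freeze ⁻¹' D := by
    ext ω
    exact iff_of_eq (hDk fun i hi => (if_pos hi).symm)
  have hind : iIndep (fun i => MeasurableSpace.comap (fun ω : Env S => ω i) inferInstance)
      (envLaw ν) :=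
    iIndepFun_infinitePi (P := fun _ : ℕ × ℤ => ν) (X := fun _ s => s) fun _ => measurable_id
  have hdisj : Disjoint (before k) {i | k ≤ i.1} := by
    rw [Set.disjoint_left]
    intro i hi hi'
    exact (not_lt.2 hi' : ¬ i.1 < k) hi
  have hI := indep_iSup_of_disjoint (fun i => (measurable_pi_apply i).comap_le) hind hdisj
  rw [Indep_iff] at hI
  have h1 : @Measurable _ _ (⨆ i ∈ before k,
      MeasurableSpace.comap (fun ω : Env S => ω i) inferInstance) _ freeze := by
    refine @measurable_pi_lambda _ _ _ (_) _ _ fun i => ?_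
    by_cases hi : i.1 < k
    · simp only [freeze, hi, if_true]
      exact (comap_measurable _).mono (le_iSup₂_of_le i hi le_rfl) le_rfl
    · simp only [freeze, hi, if_false]
      exact measurable_const
  have h2 : @Measurable _ _ (⨆ i ∈ {i : ℕ × ℤ | k ≤ i.1},
      MeasurableSpace.comap (fun ω : Env S => ω i) inferInstance) _ (shift k y) := by
    refine @measurable_pi_lambda _ _ _ (_) _ _ fun i => ?_
    exact (comap_measurable _).mono
      (le_iSup₂_of_le (i.1 + k, i.2 + y) (Nat.le_add_left k i.1) le_rfl) le_rfl
  rw [hDf, hI _ _ (h1 hD) (h2 hC), (measurePreserving_shift ν k y).measure_preimage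
    hC.nullMeasurableSet]

/-- A Markov property: on each fibre of `N`, an event of the first `k` columns, the random shift is
deterministic and `measure_inter_shift` applies. -/
lemma measure_inter_restart {k : ℕ} {D C : Set (Env S)} (hD : MeasurableSet D)
    (hDk : DependsOn (· ∈ D) (before k)) (hC : MeasurableSet C) {N : Env S → ℤ}
    (hN : Measurable N) (hNk : DependsOn N (before k)) :
    envLaw ν (D ∩ (fun ω => shift k (N ω) ω) ⁻¹' C) = envLaw ν D * envLaw ν C := by
  rw [measure_eq_tsum_inter_fiber _ hN (D ∩ _), measure_eq_tsum_inter_fiber _ hN D, ← ENNReal.tsum_mul_right]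
  refine tsum_congr fun y => ?_
  have hdep : DependsOn (· ∈ D ∩ N ⁻¹' {y}) (before k) := by
    intro ω ω' h
    simp only [Set.mem_inter_iff, Set.mem_preimage, hNk h]
    rw [show (ω ∈ D) = (ω' ∈ D) from hDk h]
  rw [← measure_inter_shift ν (hD.inter (hN (measurableSet_singleton y))) hdep hC y]
  congr 1
  ext ω
  simp only [Set.mem_inter_iff, Set.mem_preimage, Set.mem_singleton_iff]
  constructor
  · rintro ⟨⟨h1, h2⟩, rfl⟩; exact ⟨⟨h1, rfl⟩, h2⟩
  · rintro ⟨⟨h1, rfl⟩, h2⟩; exact ⟨⟨h1, h2⟩, rfl⟩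

/-- The environment seen from a height determined by the first `k` columns has the same law. -/
lemma measurePreserving_restart {k : ℕ} {N : Env S → ℤ} (hN : Measurable N)
    (hNk : DependsOn N (before k)) :
    MeasurePreserving (fun ω => shift k (N ω) ω) (envLaw ν) (envLaw ν) := by
  have hmeas := measurable_shift_random (fun _ => k) measurable_const N hN
  refine ⟨hmeas, Measure.ext fun C hC => ?_⟩
  have h := measure_inter_restart ν (k := k) MeasurableSet.univ (fun _ _ _ => by simp) hC hN hNk
  rw [Measure.map_apply hmeas hC]
  simpa using h

/-- The environment seen from a height determined by the first `k` columns is independent of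
these columns. -/
lemma indepFun_restart {k : ℕ} {N : Env S → ℤ} (hN : Measurable N)
    (hNk : DependsOn N (before k)) {X : Env S → β} (hX : Measurable X)
    (hXk : DependsOn X (before k)) :
    IndepFun X (fun ω => shift k (N ω) ω) (envLaw ν) := by
  rw [indepFun_iff_measure_inter_preimage_eq_mul]
  intro s t hs ht
  rw [(measurePreserving_restart ν hN hNk).measure_preimage ht.nullMeasurableSet]
  refine measure_inter_restart ν (hX hs) (fun ω ω' h => ?_) ht hN hNk
  simp only [Set.mem_preimage, hXk h]

end Restart

/-! ### Measurability and locality of the observables. -/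

section Measurability

lemma measurable_eq_true (i : ℕ × ℤ) : Measurable fun ω : Env Bool => ω i = true :=
  Measurable.eq_const (f := fun ω : Env Bool => ω i) (measurable_pi_apply i) true

lemma measurable_mem_entry (A : Set ℤ) (n : ℕ) (z : ℤ) :
    Measurable fun ω : Env Bool => z ∈ entry ω A n := by
  induction n generalizing z with
  | zero => exact measurable_const
  | succ n ih =>
    change Measurable fun ω : Env Bool => ∃ e, e ∈ entry ω A n ∧ ∃ y, e ≤ y ∧
      (∀ u, e ≤ u → u ≤ y → ω (n, u) = true) ∧ (z = y ∨ z = y + 1)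
    refine Measurable.exists fun e => (ih e).and (Measurable.exists fun y =>
      measurable_const.and (Measurable.and ?_ measurable_const))
    exact Measurable.forall fun u => measurable_const.imp (measurable_const.imp
      (measurable_eq_true (n, u)))

lemma measurable_nonempty_entry (A : Set ℤ) (n : ℕ) :
    Measurable fun ω : Env Bool => (entry ω A n).Nonempty :=
  Measurable.exists fun z => measurable_mem_entry A n z

/-- The second alternative accounts for the default value 0 of the supremum, which makes `top`
measurable everywhere and not only on good environments. -/
lemma csSup_eq_iff_of_int (E : Set ℤ) (m : ℤ) :
    sSup E = m ↔ (m ∈ E ∧ ∀ z, z ∈ E → z ≤ m) ∨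
      ((¬ (∃ z, z ∈ E) ∨ ¬ ∃ b, ∀ z, z ∈ E → z ≤ b) ∧ m = 0) := by
  by_cases h1 : E.Nonempty
  · by_cases h2 : BddAbove E
    · have h3 : ∃ z, z ∈ E := h1
      have h4 : ∃ b, ∀ z, z ∈ E → z ≤ b := h2
      simp only [h3, h4, not_true, or_self, false_and, or_false]
      constructor
      · rintro rfl
        exact ⟨Int.csSup_mem h1 h2, fun z hz => le_csSup h2 hz⟩
      · intro h
        exact IsGreatest.csSup_eq h
    · have h4 : ¬ ∃ b, ∀ z, z ∈ E → z ≤ b := h2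
      have h5 : ¬ (m ∈ E ∧ ∀ z, z ∈ E → z ≤ m) := fun h => h4 ⟨m, h.2⟩
      simp [h4, h5, Int.csSup_of_not_bddAbove h2, eq_comm]
  · rw [Set.not_nonempty_iff_eq_empty] at h1
    subst h1
    simp [eq_comm]

lemma measurable_top (n : ℕ) : Measurable fun ω : Env Bool => top ω n := by
  refine measurable_to_countable' fun m => ?_
  have : (fun ω : Env Bool => top ω n) ⁻¹' {m} =
      {ω | (m ∈ entry ω (Set.Iic 0) n ∧ ∀ z, z ∈ entry ω (Set.Iic 0) n → z ≤ m) ∨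
      ((¬ (∃ z, z ∈ entry ω (Set.Iic 0) n) ∨ ¬ ∃ b, ∀ z, z ∈ entry ω (Set.Iic 0) n → z ≤ b) ∧
        m = 0)} := by
    ext ω
    exact csSup_eq_iff_of_int _ _
  rw [this, measurableSet_setOfPred]
  have h := measurable_mem_entry (Set.Iic 0) n
  have hb : ∀ b, Measurable fun ω : Env Bool => ∀ z, z ∈ entry ω (Set.Iic 0) n → z ≤ b :=
    fun b => Measurable.forall fun z => (h z).imp measurable_const
  exact ((h m).and (hb m)).or (((Measurable.exists h).not.or (Measurable.exists hb).not).and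
    measurable_const)

lemma dependsOn_top (n : ℕ) : DependsOn (fun ω : Env Bool => top ω n) (before n) :=
  fun _ _ h => top_congr h

lemma measurable_surv : Measurable Surv :=
  Measurable.forall fun n => measurable_nonempty_entry {0} n

lemma measurableSet_surv : MeasurableSet {ω | Surv ω} := measurableSet_setOfPred.2 measurable_surv

/-- The environment seen from the highest entry point into column `k`. -/
noncomputable def fromTop (k : ℕ) (ω : Env Bool) : Env Bool := shift k (top ω k) ω

lemma measurable_fromTop (k : ℕ) : Measurable (fromTop k) :=
  measurable_shift_random (fun _ => k) measurable_const _ (measurable_top k)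

lemma measurable_ren (k : ℕ) : Measurable fun ω => Ren ω k :=
  measurable_surv.comp (measurable_fromTop k)

lemma measurable_sInf_nat {Ω : Type*} [MeasurableSpace Ω] {p : ℕ → Ω → Prop}
    (hp : ∀ k, Measurable (p k)) : Measurable fun ω => sInf {k | p k ω} := by
  refine measurable_to_countable' fun m => ?_
  have : (fun ω => sInf {k | p k ω}) ⁻¹' {m} =
      {ω | (p m ω ∧ ∀ k, k < m → ¬ p k ω) ∨ ((∀ k, ¬ p k ω) ∧ m = 0)} := by
    ext ω
    simp only [Set.mem_preimage, Set.mem_singleton_iff, Set.mem_ofPred_eq]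
    constructor
    · rintro rfl
      by_cases hne : {k | p k ω}.Nonempty
      · exact Or.inl ⟨Nat.sInf_mem hne, fun k hk => Nat.notMem_of_lt_sInf hk⟩
      · rw [Set.not_nonempty_iff_eq_empty] at hne
        refine Or.inr ⟨fun k hk => ?_, by simp [hne]⟩
        have : k ∈ {k | p k ω} := hk
        simp [hne] at this
    · rintro (⟨h1, h2⟩ | ⟨h1, rfl⟩)
      · exact le_antisymm (Nat.sInf_le h1) (by
          by_contra hlt
          exact h2 _ (not_le.1 hlt) (Nat.sInf_mem (s := {k | p k ω}) ⟨m, h1⟩))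
      · simp [h1]
  rw [this, measurableSet_setOfPred]
  exact ((hp m).and (Measurable.forall fun k => measurable_const.imp (hp k).not)).or
    ((Measurable.forall fun k => (hp k).not).and measurable_const)

lemma measurable_eq_false (i : ℕ × ℤ) : Measurable fun ω : Env Bool => ω i = false :=
  Measurable.eq_const (f := fun ω : Env Bool => ω i) (measurable_pi_apply i) false

lemma measurable_run : Measurable run := measurable_sInf_nat fun _ => measurable_eq_false _

lemma dependsOn_run : DependsOn run (before 1) := by
  intro ω ω' h
  have : ∀ k : ℕ, ω (0, (k : ℤ)) = ω' (0, (k : ℤ)) := fun k => h _ Nat.zero_lt_one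
  simp [run, this]

lemma measurable_topRun (n : ℕ) : Measurable fun ω => topRun ω n :=
  measurable_run.comp (measurable_fromTop n)

lemma dependsOn_topRun (n : ℕ) : DependsOn (fun ω => topRun ω n) (before (n + 1)) :=
  dependsOn_comp_shift dependsOn_run (dependsOn_top n)

lemma measurable_runSum (n : ℕ) : Measurable fun ω => runSum ω n :=
  Finset.measurable_sum _ fun j _ => measurable_topRun j

lemma dependsOn_runSum (n : ℕ) : DependsOn (fun ω => runSum ω n) (before n) := by
  intro ω ω' h
  refine Finset.sum_congr rfl fun j hj => dependsOn_topRun j fun i hi => h i ?_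
  exact before_mono (Finset.mem_range.1 hj) hi

end Measurability

/-! ### Geometric tails and integrability. -/

section Tails

/-- The law of the percolation environment with density `p`. -/
noncomputable abbrev percLaw (p : unitInterval) : Measure (Env Bool) :=
  envLaw (bernoulliMeasure true false p)

lemma lintegral_natCast_eq_tsum {Ω : Type*} [MeasurableSpace Ω] (μ : Measure Ω) {X : Ω → ℕ}
    (hX : Measurable X) : ∫⁻ ω, (X ω : ENNReal) ∂μ = ∑' m : ℕ, μ {ω | m < X ω} := by
  have h : ∀ ω, (X ω : ENNReal) = ∑' m : ℕ, Set.indicator {ω | m < X ω} (fun _ => 1) ω := by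
    intro ω
    rw [tsum_eq_sum (s := Finset.range (X ω))]
    · rw [Finset.sum_congr rfl (g := fun _ => (1 : ENNReal))]
      · simp
      · intro m hm
        exact Set.indicator_of_mem (s := {ω | m < X ω}) (Finset.mem_range.1 hm) _
    · intro m hm
      exact Set.indicator_of_notMem (s := {ω | m < X ω}) (fun h => hm (Finset.mem_range.2 h)) _
  have hm : ∀ m : ℕ, MeasurableSet {ω | m < X ω} := fun m => hX (measurableSet_Ioi (a := m))
  simp_rw [h]
  rw [lintegral_tsum fun m => (measurable_const.indicator (hm m)).aemeasurable]
  exact tsum_congr fun m => lintegral_indicator_one (hm m)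

lemma integrable_natCast_of_lintegral {Ω : Type*} [MeasurableSpace Ω] {μ : Measure Ω} {X : Ω → ℕ}
    (hX : Measurable X) (h : ∑' m : ℕ, μ {ω | m < X ω} < ⊤) :
    Integrable (fun ω => (X ω : ℝ)) μ := by
  refine ⟨(measurable_from_top.comp hX).aestronglyMeasurable, ?_⟩
  rw [HasFiniteIntegral]
  simpa [lintegral_natCast_eq_tsum μ hX] using h

lemma integrable_natCast_of_geometric {Ω : Type*} [MeasurableSpace Ω] {μ : Measure Ω} {X : Ω → ℕ}
    (hX : Measurable X) {r : ENNReal} (hr : r < 1) (h : ∀ m, μ {ω | m < X ω} ≤ r ^ m) :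
    Integrable (fun ω => (X ω : ℝ)) μ := by
  refine integrable_natCast_of_lintegral hX ((ENNReal.tsum_le_tsum h).trans_lt ?_)
  rw [ENNReal.tsum_geometric]
  simpa using hr

lemma integral_comp_measurePreserving {Ω Ω' : Type*} [MeasurableSpace Ω] [MeasurableSpace Ω']
    {μ : Measure Ω} {μ' : Measure Ω'} {φ : Ω → Ω'} (hφ : MeasurePreserving φ μ μ') {f : Ω' → ℝ}
    (hf : Measurable f) : ∫ ω, f (φ ω) ∂μ = ∫ ω, f ω ∂μ' := by
  rw [← hφ.map_eq, integral_map hφ.aemeasurable hf.aestronglyMeasurable]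

variable (p : unitInterval)

lemma percLaw_column (n m : ℕ) (b : ℤ) :
    percLaw p {ω | ∀ k < m, ω (n, b + (k : ℤ)) = true} =
      (unitInterval.toNNReal p : ENNReal) ^ m := by
  have hinj : Function.Injective fun k : ℕ => ((n, b + (k : ℤ)) : ℕ × ℤ) := by
    intro a c h; simpa using h
  have hs : {ω : Env Bool | ∀ k < m, ω (n, b + (k : ℤ)) = true} =
      Set.pi ((Finset.range m).map ⟨_, hinj⟩) fun _ => {true} := by
    ext ω; simp [Set.mem_pi]
  rw [hs, percLaw, envLaw, Measure.infinitePi_pi _ fun _ _ => measurableSet_singleton _]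
  simp

lemma percLaw_rows (n m : ℕ) (b : ℤ) :
    percLaw p {ω | ∀ k < m, ¬ ∀ i < n, ω (i, b - (k : ℤ)) = true} =
      (1 - (unitInterval.toNNReal p : ENNReal) ^ n) ^ m := by
  -- The relevant sites form an injective copy of `ℕ × ℕ`. Currying turns it into a sequence of
  -- i.i.d. rows, so the probability factors over the rows.
  set ν : Measure Bool := bernoulliMeasure true false p with hν
  let g : ℕ × ℕ → ℕ × ℤ := fun x => (x.2, b - (x.1 : ℤ))
  have hinj : Function.Injective g := by
    rintro ⟨a, c⟩ ⟨a', c'⟩ h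
    simp only [g, Prod.mk.injEq] at h ⊢
    lia
  let T : Set (ℕ → Bool) := {r | ∀ i < n, r i = true}
  have hT : T = Set.pi (Finset.range n) fun _ => {true} := by
    ext r; simp [T, Set.mem_pi]
  have hTm : MeasurableSet T := by
    rw [hT]
    exact MeasurableSet.pi (Finset.countable_toSet _) fun _ _ => measurableSet_singleton _
  have hTp : Measure.infinitePi (fun _ : ℕ => ν) T = (unitInterval.toNNReal p : ENNReal) ^ n := by
    rw [hT, Measure.infinitePi_pi _ fun _ _ => measurableSet_singleton _]
    simp [hν]
  have h1 := Measure.map_infinitePi_infinitePi_of_inj (P := fun _ : ℕ × ℤ => ν) hinj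
  have h2 := Measure.infinitePi_map_curry (fun _ _ : ℕ => ν)
  have hU : MeasurableSet (Set.pi (Finset.range m : Set ℕ) fun _ => Tᶜ) :=
    MeasurableSet.pi (Finset.countable_toSet _) fun _ _ => hTm.compl
  have h3 := Measure.infinitePi_pi (fun _ : ℕ => Measure.infinitePi fun _ : ℕ => ν)
    (s := Finset.range m) (t := fun _ => Tᶜ) fun _ _ => hTm.compl
  rw [← h2, Measure.map_apply (MeasurableEquiv.measurable _) hU, ← h1,
    Measure.map_apply (by fun_prop) ((MeasurableEquiv.measurable _) hU),
    Finset.prod_const, Finset.card_range, prob_compl_eq_one_sub hTm, hTp] at h3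
  rw [← h3]
  congr 1
  ext ω
  simp [T, g, Set.mem_pi, MeasurableEquiv.curry]

variable {p}

lemma toNNReal_lt_one (hp : p < 1) : (unitInterval.toNNReal p : ENNReal) < 1 := by
  exact_mod_cast hp

lemma toNNReal_pos (hp : 0 < p) : 0 < (unitInterval.toNNReal p : ENNReal) := by
  exact_mod_cast hp

lemma one_sub_toNNReal_pow_lt_one (hp : 0 < p) (n : ℕ) :
    1 - (unitInterval.toNNReal p : ENNReal) ^ n < 1 :=
  ENNReal.sub_lt_self (by simp) (by simp) (pow_ne_zero n (toNNReal_pos hp).ne')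

lemma measure_eq_zero_of_le_pow {Ω : Type*} [MeasurableSpace Ω] {μ : Measure Ω} {s : Set Ω}
    {r : ENNReal} (hr : r < 1) (h : ∀ m : ℕ, μ s ≤ r ^ m) : μ s = 0 :=
  le_antisymm (ge_of_tendsto' (ENNReal.tendsto_pow_atTop_nhds_zero_of_lt_one hr) h) zero_le

/-- Each failure forces a bad pattern of every length `m`, whose probability decays geometrically in
`m`. -/
lemma ae_good (hp0 : 0 < p) (hp1 : p < 1) : ∀ᵐ ω ∂percLaw p, Good ω := by
  refine ae_all_iff.2 fun n => ae_all_iff.2 fun b => Filter.Eventually.and ?_ ?_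
  · rw [ae_iff]
    refine measure_eq_zero_of_le_pow (toNNReal_lt_one hp1) fun m => ?_
    rw [← percLaw_column p n m b]
    refine measure_mono fun ω hω k _ => ?_
    by_contra h
    exact hω ⟨b + k, by lia, by simpa using h⟩
  · rw [ae_iff]
    refine measure_eq_zero_of_le_pow (one_sub_toNNReal_pow_lt_one hp0 n) fun m => ?_
    rw [← percLaw_rows p n m b]
    refine measure_mono fun ω hω k _ h => ?_
    exact hω ⟨b - k, by lia, h⟩

lemma integrable_run (hp1 : p < 1) : Integrable (fun ω => (run ω : ℝ)) (percLaw p) := by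
  refine integrable_natCast_of_geometric measurable_run (toNNReal_lt_one hp1) fun m => ?_
  rw [← percLaw_column p 0 m 0]
  refine measure_mono fun ω hω k hk => ?_
  have : m < run ω := hω
  rw [zero_add]
  exact eq_true_of_lt_run (hk.trans this)

variable (p) in
lemma measurePreserving_fromTop (k : ℕ) :
    MeasurePreserving (fromTop k) (percLaw p) (percLaw p) :=
  measurePreserving_restart _ (measurable_top k) (dependsOn_top k)

lemma integrable_topRun (hp1 : p < 1) (n : ℕ) :
    Integrable (fun ω => (topRun ω n : ℝ)) (percLaw p) :=
  (measurePreserving_fromTop p n).integrable_comp_of_integrable (integrable_run hp1)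

lemma integrable_runSum (hp1 : p < 1) (n : ℕ) :
    Integrable (fun ω => (runSum ω n : ℝ)) (percLaw p) := by
  simp only [runSum, Nat.cast_sum]
  exact integrable_finsetSum _ fun j _ => integrable_topRun hp1 j

lemma integral_runSum (hp1 : p < 1) (n : ℕ) :
    ∫ ω, (runSum ω n : ℝ) ∂percLaw p = n * ∫ ω, (run ω : ℝ) ∂percLaw p := by
  have h : ∀ j, ∫ ω, (topRun ω j : ℝ) ∂percLaw p = ∫ ω, (run ω : ℝ) ∂percLaw p := fun j =>
    integral_comp_measurePreserving (measurePreserving_fromTop p j)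
      (measurable_from_top.comp measurable_run : Measurable fun ω => (run ω : ℝ))
  simp only [runSum, Nat.cast_sum]
  rw [integral_finsetSum _ fun j _ => integrable_topRun hp1 j]
  simp [h]

/-- The depth of the first row at height at most `0` that is occupied along `n` columns. -/
noncomputable def rowDepth (n : ℕ) (ω : Env Bool) : ℕ :=
  sInf {k : ℕ | ∀ i < n, ω (i, -(k : ℤ)) = true}

/-- A fully occupied row is itself a path into column `n`. This lower bound with geometric tail
complements the upper bound by `runSum` and makes `top` integrable. -/
lemma Good.neg_rowDepth_le_top {ω : Env Bool} (h : Good ω) (n : ℕ) :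
    -(rowDepth n ω : ℤ) ≤ top ω n := by
  obtain ⟨y, hy, hr⟩ := (h n 0).2
  have hne : {k : ℕ | ∀ i < n, ω (i, -(k : ℤ)) = true}.Nonempty := by
    refine ⟨(-y).toNat, fun i hi => ?_⟩
    rw [Int.toNat_of_nonneg (by lia), neg_neg]
    exact hr i hi
  have hm : ∀ i < n, ω (i, -(rowDepth n ω : ℤ)) = true := Nat.sInf_mem hne
  exact (h.isGreatest_entry_Iic n).2 (mem_entry_of_row (by simp) hm)

lemma integrable_rowDepth (hp0 : 0 < p) (n : ℕ) :
    Integrable (fun ω => (rowDepth n ω : ℝ)) (percLaw p) := by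
  refine integrable_natCast_of_geometric (measurable_sInf_nat fun k => ?_)
    (one_sub_toNNReal_pow_lt_one hp0 n) fun m => ?_
  · exact Measurable.forall fun i => measurable_const.imp (measurable_eq_true _)
  · rw [← percLaw_rows p n m 0]
    refine measure_mono fun ω hω k hk => ?_
    have h1 : m < rowDepth n ω := hω
    rw [zero_sub]
    exact Nat.notMem_of_lt_sInf (hk.trans h1)

lemma Good.top_le_runSum {ω : Env Bool} (h : Good ω) (n : ℕ) : top ω n ≤ runSum ω n := by
  simpa [runSum] using h.top_le_add_runSum (Nat.zero_le n)

lemma measurable_top_real (n : ℕ) : Measurable fun ω : Env Bool => (top ω n : ℝ) :=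
  measurable_from_top.comp (measurable_top n)

lemma integrable_top (hp0 : 0 < p) (hp1 : p < 1) (n : ℕ) :
    Integrable (fun ω => (top ω n : ℝ)) (percLaw p) := by
  refine ((integrable_runSum hp1 n).add (integrable_rowDepth hp0 n)).mono'
    (measurable_top_real n).aestronglyMeasurable ?_
  filter_upwards [ae_good hp0 hp1] with ω hω
  have h1 : -(rowDepth n ω : ℝ) ≤ top ω n := by exact_mod_cast hω.neg_rowDepth_le_top n
  have h2 : (top ω n : ℝ) ≤ runSum ω n := by exact_mod_cast hω.top_le_runSum n
  have h3 : (0 : ℝ) ≤ rowDepth n ω := by positivity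
  have h4 : (0 : ℝ) ≤ runSum ω n := by positivity
  rw [Real.norm_eq_abs, abs_le]
  constructor <;> simp only [Pi.add_apply] <;> linarith

end Tails

/-! ### Strong laws and interpolation between sampled times. -/

section StrongLaw

variable {Ω α : Type*} [MeasurableSpace Ω] {μ : Measure Ω}

lemma indepFun_comp_measurePreserving {β γ : Type*} [MeasurableSpace β] [MeasurableSpace γ]
    {T : Ω → Ω} (hT : MeasurePreserving T μ μ) {f : Ω → β} {g : Ω → γ} (hf : Measurable f)
    (hg : Measurable g) (h : IndepFun f g μ) :
    IndepFun (fun ω => f (T ω)) (fun ω => g (T ω)) μ := by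
  rw [indepFun_iff_measure_inter_preimage_eq_mul] at h ⊢
  intro s t hs ht
  have := h s t hs ht
  rw [← hT.measure_preimage ((hf hs).inter (hg ht)).nullMeasurableSet,
    ← hT.measure_preimage (hf hs).nullMeasurableSet,
    ← hT.measure_preimage (hg ht).nullMeasurableSet] at this
  exact this

/-- The strong law of large numbers along the iterates of a measure preserving map `T` such that
the observable is independent of `T`. -/
lemma strong_law_iterate {T : Ω → Ω} (hT : MeasurePreserving T μ μ) {f : Ω → ℝ}
    (hf : Measurable f) (hind : IndepFun f T μ) (hint : Integrable f μ) :
    ∀ᵐ ω ∂μ, Tendsto (fun n : ℕ => (∑ i ∈ Finset.range n, f (T^[i] ω)) / n) atTop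
      (𝓝 (∫ ω, f ω ∂μ)) := by
  have hlt : ∀ i j, i < j → IndepFun (fun ω => f (T^[i] ω)) (fun ω => f (T^[j] ω)) μ := by
    intro i j hij
    obtain ⟨d, rfl⟩ := Nat.exists_eq_add_of_lt hij
    have h1 : IndepFun f (fun ω => f (T^[d] (T ω))) μ :=
      hind.comp measurable_id (hf.comp (hT.iterate d).measurable)
    have h2 := indepFun_comp_measurePreserving (hT.iterate i) hf
      (hf.comp ((hT.iterate d).measurable.comp hT.measurable)) h1
    convert h2 using 2 with ω
    simp only [Function.comp]
    rw [← Function.iterate_succ_apply, ← Function.iterate_add_apply]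
    congr 2
    lia
  refine strong_law_ae_real (fun i ω => f (T^[i] ω)) (by simpa using hint) ?_ ?_
  · intro i j hij
    rcases lt_or_gt_of_ne hij with h | h
    · exact hlt i j h
    · exact (hlt j i h).symm
  · intro i
    refine ⟨(hf.comp (hT.iterate i).measurable).aemeasurable, by simpa using hf.aemeasurable, ?_⟩
    have : μ.map (fun ω => f (T^[i] ω)) = (μ.map T^[i]).map f :=
      (Measure.map_map hf (hT.iterate i).measurable).symm
    rw [this, (hT.iterate i).map_eq]
    rfl

/-- The strong law of large numbers for observables of the environments seen from the highest
entry points into the columns `0, k, 2k, …`. -/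
lemma strong_law_fromTop (p : unitInterval) {k : ℕ} {f : Env Bool → ℝ} (hf : Measurable f)
    (hfk : DependsOn f (before k)) (hint : Integrable f (percLaw p)) :
    ∀ᵐ ω ∂percLaw p, Tendsto (fun n : ℕ => (∑ i ∈ Finset.range n, f (fromTop (i * k) ω)) / n) atTop
      (𝓝 (∫ ω, f ω ∂percLaw p)) := by
  have hlt : ∀ i j, i < j →
      IndepFun (fun ω => f (fromTop (i * k) ω)) (fun ω => f (fromTop (j * k) ω)) (percLaw p) := by
    intro i j hij
    have h1 : DependsOn (fun ω => f (fromTop (i * k) ω)) (before (j * k)) :=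
      (dependsOn_comp_shift hfk (dependsOn_top (i * k))).mono (before_mono (by
        calc i * k + k = (i + 1) * k := by ring
          _ ≤ j * k := Nat.mul_le_mul_right k hij))
    exact (indepFun_restart _ (measurable_top (j * k)) (dependsOn_top (j * k))
      (hf.comp (measurable_fromTop (i * k))) h1).comp measurable_id hf
  have hmap : ∀ j, (percLaw p).map (fun ω => f (fromTop j ω)) = (percLaw p).map f := by
    intro j
    have : (percLaw p).map (fun ω => f (fromTop j ω)) = ((percLaw p).map (fromTop j)).map f :=
      (Measure.map_map hf (measurable_fromTop j)).symm
    rw [this, (measurePreserving_fromTop p j).map_eq]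
  have h := strong_law_ae_real (μ := percLaw p) (fun i ω => f (fromTop (i * k) ω))
    ((measurePreserving_fromTop p (0 * k)).integrable_comp_of_integrable hint) ?_ ?_
  · rwa [integral_comp_measurePreserving (measurePreserving_fromTop p _) hf] at h
  · intro i j hij
    rcases lt_or_gt_of_ne hij with h | h
    · exact hlt i j h
    · exact (hlt j i h).symm
  · intro i
    exact ⟨(hf.comp (measurable_fromTop _)).aemeasurable, (hf.comp (measurable_fromTop _)).aemeasurable,
      by rw [hmap, hmap]⟩

/-- The runs above successive tops use one fresh column each. -/
lemma tendsto_runSum {p : unitInterval} (hp1 : p < 1) :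
    ∀ᵐ ω ∂percLaw p, Tendsto (fun n : ℕ => (runSum ω n : ℝ) / n) atTop
      (𝓝 (∫ ω, (run ω : ℝ) ∂percLaw p)) := by
  have h := strong_law_fromTop p (k := 1) (f := fun ω => (run ω : ℝ))
    (measurable_from_top.comp measurable_run)
    (fun _ _ h => by simp only [dependsOn_run h]) (integrable_run hp1)
  filter_upwards [h] with ω hω
  refine hω.congr fun n => ?_
  simp [runSum, topRun, fromTop]

variable [IsProbabilityMeasure μ]

/-- Summing the product formula over fibres extends it to all preimages under `F`. The full preimage
gives invariance of the measure, and then the formula is independence. -/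
lemma measurePreserving_and_indepFun_of_fiber [Countable α] [MeasurableSpace α]
    [MeasurableSingletonClass α] {F : Ω → α} (hF : Measurable F) {T : Ω → Ω} (hT : Measurable T)
    (h : ∀ a C, MeasurableSet C → μ (F ⁻¹' {a} ∩ T ⁻¹' C) = μ (F ⁻¹' {a}) * μ C) :
    MeasurePreserving T μ μ ∧ IndepFun F T μ := by
  have key : ∀ B C, MeasurableSet C → μ (F ⁻¹' B ∩ T ⁻¹' C) = μ (F ⁻¹' B) * μ C := by
    intro B C hC
    rw [measure_eq_tsum_inter_fiber μ hF (F ⁻¹' B ∩ _), measure_eq_tsum_inter_fiber μ hF (F ⁻¹' B),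
      ← ENNReal.tsum_mul_right]
    refine tsum_congr fun a => ?_
    by_cases ha : a ∈ B
    · have h1 : F ⁻¹' B ∩ F ⁻¹' {a} = F ⁻¹' {a} :=
        Set.inter_eq_right.2 (Set.preimage_mono (Set.singleton_subset_iff.2 ha))
      rw [Set.inter_right_comm, h1, h a C hC]
    · have h1 : F ⁻¹' B ∩ F ⁻¹' {a} = ∅ := by
        rw [← Set.preimage_inter, Set.inter_singleton_eq_empty.2 ha, Set.preimage_empty]
      rw [Set.inter_right_comm, h1]
      simp
  have hpres : MeasurePreserving T μ μ := by
    refine ⟨hT, Measure.ext fun C hC => ?_⟩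
    rw [Measure.map_apply hT hC]
    simpa using key Set.univ C hC
  refine ⟨hpres, ?_⟩
  rw [indepFun_iff_measure_inter_preimage_eq_mul]
  intro s t _ ht
  rw [key s t ht, hpres.measure_preimage ht.nullMeasurableSet]

end StrongLaw

/-- If `a` grows by controlled amounts between the times `T k`, its growth rate is determined by
the values at these times. -/
lemma tendsto_div_of_subsequence {T : ℕ → ℕ} (hT : StrictMono T) (hT0 : T 0 = 0) {a s : ℕ → ℝ}
    {m h c : ℝ} (hm : 0 < m) (hTm : Tendsto (fun k : ℕ => (T k : ℝ) / k) atTop (𝓝 m))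
    (hah : Tendsto (fun k : ℕ => a (T k) / k) atTop (𝓝 h))
    (hs : Tendsto (fun n : ℕ => s n / n) atTop (𝓝 c))
    (hlow : ∀ k n, T k ≤ n → a (T k) ≤ a n)
    (hup : ∀ k n, T k ≤ n → a n ≤ a (T k) + (s n - s (T k))) :
    Tendsto (fun n : ℕ => a n / n) atTop (𝓝 (h / m)) := by
  -- The index of the last time `T k ≤ n`; searching up to `n` suffices because `k ≤ T k`.
  let κ : ℕ → ℕ := fun n => Nat.findGreatest (fun k => T k ≤ n) n
  have hκ1 : ∀ n, T (κ n) ≤ n := fun n =>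
    Nat.findGreatest_spec (P := fun k => T k ≤ n) (Nat.zero_le n) (by simp [hT0])
  have hκ2 : ∀ n, n < T (κ n + 1) := by
    intro n
    by_contra hle
    have h1 : κ n + 1 ≤ n := (hT.id_le _).trans (not_lt.1 hle)
    have := Nat.le_findGreatest (P := fun k => T k ≤ n) h1 (not_lt.1 hle)
    exact absurd this (by simp [κ])
  have hκ : Tendsto κ atTop atTop := by
    refine tendsto_atTop.2 fun b => ?_
    filter_upwards [eventually_ge_atTop (T b)] with n hn
    by_contra hlt
    exact absurd (hκ2 n) (not_lt.2 ((hT.monotone (by lia)).trans hn))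
  have hTκ : Tendsto (fun n => (T (κ n) : ℝ) / κ n) atTop (𝓝 m) := hTm.comp hκ
  have hTκ1 : Tendsto (fun n => (T (κ n + 1) : ℝ) / κ n) atTop (𝓝 m) := by
    have h1 : Tendsto (fun k : ℕ => (T (k + 1) : ℝ) / k) atTop (𝓝 m) := by
      have h2 := (hTm.comp (tendsto_add_atTop_nat 1)).mul
        ((tendsto_const_nhds (x := (1 : ℝ))).add tendsto_one_div_atTop_nhds_zero_nat)
      rw [add_zero, mul_one] at h2
      refine h2.congr' ?_
      filter_upwards [eventually_gt_atTop 0] with k hk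
      have : (k : ℝ) ≠ 0 := by positivity
      simp only [Function.comp]
      push_cast
      field_simp
    exact h1.comp hκ
  have hnκ : Tendsto (fun n : ℕ => (n : ℝ) / κ n) atTop (𝓝 m) := by
    refine tendsto_of_tendsto_of_tendsto_of_le_of_le hTκ hTκ1 (fun n => ?_) (fun n => ?_)
    · exact div_le_div_of_nonneg_right (Nat.cast_le.2 (hκ1 n)) (by positivity)
    · exact div_le_div_of_nonneg_right (Nat.cast_le.2 (hκ2 n).le) (by positivity)
  have hκn : Tendsto (fun n : ℕ => (κ n : ℝ) / n) atTop (𝓝 m⁻¹) := by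
    refine (hnκ.inv₀ hm.ne').congr fun n => by rw [inv_div]
  have hlo : Tendsto (fun n : ℕ => a (T (κ n)) / n) atTop (𝓝 (h / m)) := by
    have h1 := (hah.comp hκ).mul hκn
    refine h1.congr' ?_
    filter_upwards [hκ.eventually_gt_atTop 0] with n hn
    have : (κ n : ℝ) ≠ 0 := by positivity
    simp only [Function.comp]
    field_simp
  -- Since `T (κ n) / n` tends to 1, the excess `s n - s (T (κ n))` is negligible relative to `n`.
  have hsT : Tendsto (fun n : ℕ => s (T (κ n)) / n) atTop (𝓝 c) := by
    have h1 := ((hs.comp (hT.tendsto_atTop.comp hκ)).mul hTκ).mul hκn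
    rw [mul_assoc, mul_inv_cancel₀ hm.ne', mul_one] at h1
    refine h1.congr' ?_
    filter_upwards [hκ.eventually_gt_atTop 0] with n hn
    have h2 : (κ n : ℝ) ≠ 0 := by positivity
    have h3 : (T (κ n) : ℝ) ≠ 0 := by
      have := hn.trans_le (hT.id_le (κ n))
      positivity
    simp only [Function.comp]
    field_simp
  have hhi : Tendsto (fun n : ℕ => a (T (κ n)) / n + (s n / n - s (T (κ n)) / n)) atTop
      (𝓝 (h / m)) := by
    simpa using hlo.add (hs.sub hsT)
  refine tendsto_of_tendsto_of_tendsto_of_le_of_le hlo hhi (fun n => ?_) (fun n => ?_)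
  · exact div_le_div_of_nonneg_right (hlow _ _ (hκ1 n)) (by positivity)
  · have := div_le_div_of_nonneg_right (hup _ _ (hκ1 n)) (Nat.cast_nonneg (α := ℝ) n)
    simpa [add_div, sub_div] using this

/-! ### Regeneration structure under the law conditioned on survival. -/

section Regeneration

/-- The first column after column `0` at which the highest entry point reaches all columns. -/
noncomputable def gap (ω : Env Bool) : ℕ := sInf {n | 1 ≤ n ∧ Ren ω n}

/-- The height of the highest entry point at the first regeneration. -/
noncomputable def rise (ω : Env Bool) : ℤ := top ω (gap ω)

/-- The environment seen from the first regeneration point. -/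
noncomputable def regen (ω : Env Bool) : Env Bool := shift (gap ω) (rise ω) ω

lemma measurable_gap : Measurable gap :=
  measurable_sInf_nat fun n => measurable_const.and (measurable_ren n)

lemma measurable_rise : Measurable rise := by
  have h : Measurable fun x : ℕ × Env Bool => top x.2 x.1 :=
    measurable_from_prod_countable_right fun n => measurable_top n
  exact h.comp (measurable_gap.prodMk measurable_id)

lemma measurable_regen : Measurable regen :=
  measurable_shift_random _ measurable_gap _ measurable_rise

/-- The origin survives and there is no regeneration in the columns `1, …, m`. -/
def NoRen (m : ℕ) (ω : Env Bool) : Prop := Surv ω ∧ ∀ i, 1 ≤ i → i ≤ m → ¬ Ren ω i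

lemma measurable_noRen (m : ℕ) : Measurable (NoRen m) :=
  measurable_surv.and (Measurable.forall fun i => measurable_const.imp (measurable_const.imp
    (measurable_ren i).not))

variable {p : unitInterval}

/-- Looking for the last regeneration before column `n` bounds the mean regeneration time. -/
lemma tsum_noRen_le_one (hp0 : 0 < p) (hp1 : p < 1) :
    ∑' m : ℕ, percLaw p {ω | NoRen m ω} ≤ 1 := by
  refine ENNReal.tsum_le_of_sum_range_le fun n => ?_
  let B : ℕ → Set (Env Bool) := fun j => {ω | Ren ω j ∧ ∀ i, j < i → i < n → ¬ Ren ω i}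
  have hB : ∀ j, MeasurableSet (B j) := fun j => measurableSet_setOfPred.2
    ((measurable_ren j).and (Measurable.forall fun i => measurable_const.imp
      (measurable_const.imp (measurable_ren i).not)))
  -- Seen from the top of column `j`, an environment with the same law, `B j` says that the origin
  -- survives with no regeneration in the remaining `n - 1 - j` columns.
  have hBj : ∀ j ∈ Finset.range n, percLaw p {ω | NoRen (n - 1 - j) ω} = percLaw p (B j) := by
    intro j hj
    rw [Finset.mem_range] at hj
    rw [← (measurePreserving_fromTop p j).measure_preimage
      (measurableSet_setOfPred.2 (measurable_noRen _)).nullMeasurableSet]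
    refine measure_congr ?_
    filter_upwards [ae_good hp0 hp1] with ω hω
    refine propext ⟨fun h => ⟨h.1, fun i hji hin hr => ?_⟩, fun h => ⟨h.1, fun i hi hin hr => ?_⟩⟩
    · obtain ⟨d, rfl⟩ := Nat.exists_eq_add_of_lt hji
      rw [add_assoc, hω.ren_add h.1] at hr
      exact h.2 (d + 1) (by lia) (by lia) hr
    · exact h.2 (j + i) (by lia) (by lia) ((hω.ren_add h.1 i).2 hr)
  rw [← Finset.sum_range_reflect, Finset.sum_congr rfl hBj, ← measure_biUnion_finset]
  · exact prob_le_one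
  · intro i hi j hj hij
    rw [Function.onFun, Set.disjoint_left]
    intro ω h1 h2
    simp only [Finset.coe_range, Set.mem_Iio] at hi hj
    rcases lt_or_gt_of_ne hij with h | h
    · exact h1.2 j h hj h2.1
    · exact h2.2 i h hi h1.1
  · exact fun j _ => hB j

/-- Summability forces the probability of no regeneration up to `m` to vanish, so on survival the
infimum in `gap` is over a nonempty set. -/
lemma ae_gap_spec (hp0 : 0 < p) (hp1 : p < 1) :
    ∀ᵐ ω ∂percLaw p, Surv ω → 1 ≤ gap ω ∧ Ren ω (gap ω) := by
  have h0 : Tendsto (fun m => percLaw p {ω | NoRen m ω}) atTop (𝓝 0) :=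
    ENNReal.tendsto_atTop_zero_of_tsum_ne_top
      ((tsum_noRen_le_one hp0 hp1).trans_lt ENNReal.one_lt_top).ne
  rw [ae_iff]
  refine le_antisymm (ge_of_tendsto' h0 fun m => measure_mono fun ω hω => ?_) zero_le
  simp only [Set.mem_ofPred_eq, Classical.not_imp] at hω
  refine ⟨hω.1, fun i hi _ hr => hω.2 ?_⟩
  exact Nat.sInf_mem (s := {n | 1 ≤ n ∧ Ren ω n}) ⟨i, hi, hr⟩

/-- The part of the first regeneration event that is determined by the columns before it. -/
def Past (s : ℕ) (y : ℤ) (ω : Env Bool) : Prop :=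
  (entry ω {0} s).Nonempty ∧ top ω s = y ∧
    ∀ j, 1 ≤ j → j < s → ¬ (entry (fromTop j ω) {0} (s - j)).Nonempty

lemma measurable_past (s : ℕ) (y : ℤ) : Measurable (Past s y) :=
  (measurable_nonempty_entry {0} s).and (((measurable_top s).eq_const y).and
    (Measurable.forall fun j => measurable_const.imp (measurable_const.imp
      ((measurable_nonempty_entry {0} (s - j)).comp (measurable_fromTop j)).not)))

lemma dependsOn_past (s : ℕ) (y : ℤ) : DependsOn (Past s y) (before s) := by
  intro ω ω' h
  have h1 : entry ω {0} s = entry ω' {0} s := entry_congr h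
  have h2 : top ω s = top ω' s := top_congr h
  have h3 : ∀ j < s, entry (fromTop j ω) {0} (s - j) = entry (fromTop j ω') {0} (s - j) := by
    intro j hj
    have := dependsOn_comp_shift (f := fun ω => entry ω {0} (s - j)) (k := s - j) (j := j)
      (fun _ _ h => entry_congr h) (dependsOn_top j)
    exact this fun i hi => h i (before_mono (by lia) hi)
  simp only [Past, h1, h2]
  congr! 6 with j hj1 hj2
  rw [h3 j hj2]

/-- Splits the first regeneration event into past and future: given survival from the top of column
`s`, each question about an earlier column reduces by `Good.ren_iff_nonempty` to reaching column
`s`. -/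
lemma past_iff {ω : Env Bool} (h : Good ω) (hg : Surv ω → 1 ≤ gap ω ∧ Ren ω (gap ω)) {s : ℕ}
    (hs : 1 ≤ s) {y : ℤ} {C : Set (Env Bool)} :
    (Surv ω ∧ (gap ω = s ∧ rise ω = y) ∧ regen ω ∈ C) ↔
      Past s y ω ∧ Surv (fromTop s ω) ∧ fromTop s ω ∈ C := by
  have hpast : ∀ j, j ≤ s → Ren ω s →
      (Ren ω j ↔ (entry (fromTop j ω) {0} (s - j)).Nonempty) := by
    intro j hj hr
    obtain ⟨d, rfl⟩ := Nat.exists_eq_add_of_le hj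
    rw [Nat.add_sub_cancel_left]
    exact h.ren_iff_nonempty hr
  have h0 : fromTop 0 ω = ω := by simp [fromTop]
  constructor
  · rintro ⟨hsurv, ⟨rfl, rfl⟩, hC⟩
    obtain ⟨-, hr⟩ := hg hsurv
    refine ⟨⟨hsurv _, rfl, fun j hj1 hj2 hne => ?_⟩, hr, hC⟩
    exact Nat.notMem_of_lt_sInf hj2 ⟨hj1, (hpast j hj2.le hr).2 hne⟩
  · rintro ⟨⟨hne, rfl, hno⟩, hr, hC⟩
    have hsurv : Surv ω := ren_zero.1 ((hpast 0 (Nat.zero_le s) hr).2 (by simpa [h0] using hne))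
    have hgap : gap ω = s := by
      refine le_antisymm (Nat.sInf_le ⟨hs, hr⟩) ?_
      by_contra hlt
      obtain ⟨h1, h2⟩ := hg hsurv
      exact hno _ h1 (not_le.1 hlt) ((hpast _ (not_le.1 hlt).le hr).1 h2)
    refine ⟨hsurv, ⟨hgap, by rw [rise, hgap]⟩, ?_⟩
    rw [regen, rise, hgap]
    exact hC

/-- The law of the environment conditioned on the survival of the origin. -/
noncomputable def survLaw (p : unitInterval) : Measure (Env Bool) :=
  ProbabilityTheory.cond (percLaw p) {ω | Surv ω}

lemma survLaw_apply (s : Set (Env Bool)) :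
    survLaw p s = (percLaw p {ω | Surv ω})⁻¹ * percLaw p ({ω | Surv ω} ∩ s) := by
  rw [survLaw, cond_apply measurableSet_surv]

lemma ae_survLaw {P : Env Bool → Prop} (h : ∀ᵐ ω ∂percLaw p, Surv ω → P ω) :
    ∀ᵐ ω ∂survLaw p, P ω := by
  refine Measure.ae_smul_measure ?_ _
  exact (ae_restrict_iff' measurableSet_surv).2 h

lemma ae_of_ae_survLaw {P : Env Bool → Prop} (h : ∀ᵐ ω ∂survLaw p, P ω) :
    ∀ᵐ ω ∂percLaw p, Surv ω → P ω := by
  refine (ae_restrict_iff' measurableSet_surv).1 ?_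
  have h' := h
  rw [survLaw, ProbabilityTheory.cond] at h'
  rwa [Measure.ae_ennreal_smul_measure_iff (by simp)] at h'

lemma isProbabilityMeasure_survLaw (hθ : percLaw p {ω | Surv ω} ≠ 0) :
    IsProbabilityMeasure (survLaw p) := cond_isProbabilityMeasure hθ

lemma survLaw_fiber (hp0 : 0 < p) (hp1 : p < 1) (hθ : percLaw p {ω | Surv ω} ≠ 0) (a : ℕ × ℤ)
    {C : Set (Env Bool)} (hC : MeasurableSet C) :
    survLaw p ((fun ω => (gap ω, rise ω)) ⁻¹' {a} ∩ regen ⁻¹' C) =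
      survLaw p ((fun ω => (gap ω, rise ω)) ⁻¹' {a}) * survLaw p C := by
  obtain ⟨s, y⟩ := a
  have hF : Measurable fun ω => (gap ω, rise ω) := measurable_gap.prodMk measurable_rise
  have hθ' : percLaw p {ω | Surv ω} ≠ ⊤ := measure_ne_top _ _
  have hgap := ae_gap_spec hp0 hp1
  rcases Nat.eq_zero_or_pos s with rfl | hs
  -- The value 0 of `gap` is excluded almost surely on survival.
  · have h0 : survLaw p ((fun ω => (gap ω, rise ω)) ⁻¹' {(0, y)}) = 0 := by
      have : ∀ᵐ ω ∂survLaw p, ω ∉ (fun ω => (gap ω, rise ω)) ⁻¹' {(0, y)} := by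
        refine ae_survLaw ?_
        filter_upwards [hgap] with ω hω hs h
        simp only [Set.mem_preimage, Set.mem_singleton_iff, Prod.mk.injEq] at h
        exact absurd (hω hs).1 (by simp [h.1])
      exact measure_eq_zero_iff_ae_notMem.2 this
    rw [h0, zero_mul]
    exact measure_mono_null Set.inter_subset_left h0
  · have key : ∀ C, MeasurableSet C →
        percLaw p ({ω | Surv ω} ∩ ((fun ω => (gap ω, rise ω)) ⁻¹' {(s, y)} ∩ regen ⁻¹' C)) =
          percLaw p {ω | Past s y ω} * percLaw p ({ω | Surv ω} ∩ C) := by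
      intro C hC
      rw [← measure_inter_restart _ (measurableSet_setOfPred.2 (measurable_past s y))
        (dependsOn_past s y) (measurableSet_surv.inter hC) (measurable_top s) (dependsOn_top s)]
      refine measure_congr ?_
      filter_upwards [ae_good hp0 hp1, hgap] with ω hω hg
      refine propext (Iff.trans ?_ (past_iff hω hg hs (y := y) (C := C)))
      exact and_congr Iff.rfl (and_congr Prod.mk_inj Iff.rfl)
    -- Taking `C` to be everything evaluates the mass of the fibre itself.
    have key' := key Set.univ MeasurableSet.univ
    rw [Set.preimage_univ, Set.inter_univ, Set.inter_univ] at key'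
    rw [survLaw_apply, key C hC, survLaw_apply, key', survLaw_apply]
    calc _ = (percLaw p {ω | Surv ω})⁻¹ *
          (percLaw p {ω | Past s y ω} * percLaw p ({ω | Surv ω} ∩ C)) *
          ((percLaw p {ω | Surv ω})⁻¹ * percLaw p {ω | Surv ω}) := by
          rw [ENNReal.inv_mul_cancel hθ hθ', mul_one]
      _ = _ := by ring

lemma regen_spec (hp0 : 0 < p) (hp1 : p < 1) (hθ : percLaw p {ω | Surv ω} ≠ 0) :
    MeasurePreserving regen (survLaw p) (survLaw p) ∧
      IndepFun (fun ω => (gap ω, rise ω)) regen (survLaw p) := by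
  have := isProbabilityMeasure_survLaw hθ
  exact measurePreserving_and_indepFun_of_fiber (measurable_gap.prodMk measurable_rise)
    measurable_regen fun a C hC => survLaw_fiber hp0 hp1 hθ a hC

/-- The tail events of `gap` on survival lie in the events `NoRen m`, whose probabilities are
summable. -/
lemma integrable_gap (hp0 : 0 < p) (hp1 : p < 1) (hθ : percLaw p {ω | Surv ω} ≠ 0) :
    Integrable (fun ω => (gap ω : ℝ)) (survLaw p) := by
  refine integrable_natCast_of_lintegral measurable_gap ?_
  have hle : ∀ m, survLaw p {ω | m < gap ω} ≤
      (percLaw p {ω | Surv ω})⁻¹ * percLaw p {ω | NoRen m ω} := by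
    intro m
    rw [survLaw_apply]
    gcongr
    rintro ω ⟨h1, h2⟩
    refine ⟨h1, fun i hi him hr => ?_⟩
    exact Nat.notMem_of_lt_sInf (him.trans_lt h2) ⟨hi, hr⟩
  refine (ENNReal.tsum_le_tsum hle).trans_lt ?_
  rw [ENNReal.tsum_mul_left]
  exact ENNReal.mul_lt_top (by simpa [pos_iff_ne_zero] using hθ)
    ((tsum_noRen_le_one hp0 hp1).trans_lt ENNReal.one_lt_top)

/-- The column of the `k`-th regeneration. -/
noncomputable def renTime (ω : Env Bool) (k : ℕ) : ℕ :=
  ∑ i ∈ Finset.range k, gap (regen^[i] ω)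

lemma iterate_regen {ω : Env Bool} (h : Good ω)
    (hg : ∀ i, Surv (regen^[i] ω)) (k : ℕ) :
    regen^[k] ω = fromTop (renTime ω k) ω ∧
      top ω (renTime ω k) = ∑ i ∈ Finset.range k, rise (regen^[i] ω) := by
  induction k with
  | zero => simp [renTime, fromTop]
  | succ k ih =>
    obtain ⟨h1, h2⟩ := ih
    have hT : renTime ω (k + 1) = renTime ω k + gap (regen^[k] ω) := Finset.sum_range_succ _ _
    have hs : (entry (shift (renTime ω k) (top ω (renTime ω k)) ω) {0}
        (gap (regen^[k] ω))).Nonempty := by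
      have := hg k
      rw [h1] at this
      rw [h1]
      exact this _
    have htop : top ω (renTime ω (k + 1)) = top ω (renTime ω k) + rise (regen^[k] ω) := by
      rw [hT, h.top_add hs, rise]
      congr 2
      exact h1.symm
    refine ⟨?_, by rw [htop, h2, Finset.sum_range_succ]⟩
    rw [Function.iterate_succ_apply', regen, fromTop, htop, hT]
    conv_lhs => rw [h1]
    rw [fromTop, shift_shift, ← fromTop, ← h1]

lemma ae_iterate_regen (hp0 : 0 < p) (hp1 : p < 1) (hθ : percLaw p {ω | Surv ω} ≠ 0) :
    ∀ᵐ ω ∂survLaw p, Good ω ∧ ∀ i, Surv (regen^[i] ω) ∧ 1 ≤ gap (regen^[i] ω) ∧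
      0 ≤ rise (regen^[i] ω) := by
  have h1 : ∀ᵐ ω ∂survLaw p, Good ω ∧ Surv ω ∧ 1 ≤ gap ω ∧ 0 ≤ rise ω := by
    refine ae_survLaw ?_
    filter_upwards [ae_good hp0 hp1, ae_gap_spec hp0 hp1] with ω h2 h3 h4
    exact ⟨h2, h4, (h3 h4).1, h2.top_nonneg (h4 _)⟩
  have h2 : ∀ i, ∀ᵐ ω ∂survLaw p, Surv (regen^[i] ω) ∧ 1 ≤ gap (regen^[i] ω) ∧
      0 ≤ rise (regen^[i] ω) := by
    intro i
    have h := ((regen_spec hp0 hp1 hθ).1.iterate i).quasiMeasurePreserving.ae h1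
    filter_upwards [h] with ω hω
    exact hω.2
  filter_upwards [h1, ae_all_iff.2 h2] with ω h3 h4
  exact ⟨h3.1, h4⟩

lemma strong_law_regen (hp0 : 0 < p) (hp1 : p < 1) (hθ : percLaw p {ω | Surv ω} ≠ 0)
    (f : ℕ × ℤ → ℝ) (hf : Integrable (fun ω => f (gap ω, rise ω)) (survLaw p)) :
    ∀ᵐ ω ∂survLaw p, Tendsto (fun n : ℕ => (∑ i ∈ Finset.range n,
      f (gap (regen^[i] ω), rise (regen^[i] ω))) / n) atTop
      (𝓝 (∫ ω, f (gap ω, rise ω) ∂survLaw p)) := by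
  have := isProbabilityMeasure_survLaw hθ
  obtain ⟨h1, h2⟩ := regen_spec hp0 hp1 hθ
  have hfm : Measurable f := measurable_of_countable f
  exact strong_law_iterate h1 (hfm.comp (measurable_gap.prodMk measurable_rise))
    (h2.comp hfm measurable_id) hf

end Regeneration

/-! ### Existence of the slope. -/

section Slope

variable {p : unitInterval}

lemma strictMono_renTime {ω : Env Bool} (h : ∀ i, 1 ≤ gap (regen^[i] ω)) :
    StrictMono (renTime ω) :=
  strictMono_nat_of_lt_succ fun k => by
    rw [renTime, renTime, Finset.sum_range_succ]
    have := h k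
    lia

lemma tendsto_renTime (hp0 : 0 < p) (hp1 : p < 1) (hθ : percLaw p {ω | Surv ω} ≠ 0) :
    ∀ᵐ ω ∂survLaw p, Tendsto (fun k : ℕ => (renTime ω k : ℝ) / k) atTop
      (𝓝 (∫ ω, (gap ω : ℝ) ∂survLaw p)) := by
  filter_upwards [strong_law_regen hp0 hp1 hθ (fun a => (a.1 : ℝ)) (integrable_gap hp0 hp1 hθ)]
    with ω hω
  simpa [renTime] using hω

lemma integral_gap_pos (hp0 : 0 < p) (hp1 : p < 1) (hθ : percLaw p {ω | Surv ω} ≠ 0) :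
    0 < ∫ ω, (gap ω : ℝ) ∂survLaw p := by
  have := isProbabilityMeasure_survLaw hθ
  have h : (fun _ => (1 : ℝ)) ≤ᵐ[survLaw p] fun ω => (gap ω : ℝ) := by
    filter_upwards [ae_iterate_regen hp0 hp1 hθ] with ω hω
    exact_mod_cast (hω.2 0).2.1
  have h1 := integral_mono_ae (integrable_const 1) (integrable_gap hp0 hp1 hθ) h
  have h2 : ∫ _ω, (1 : ℝ) ∂survLaw p = 1 := by simp
  linarith

/-- The strong law applies to the rises truncated at `K`. Their averages are at most `runSum` at the
regeneration times divided by the number of regenerations, which tends to `c * m`. This bound is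
uniform in `K`, so the truncation can be removed. -/
lemma integrable_rise (hp0 : 0 < p) (hp1 : p < 1) (hθ : percLaw p {ω | Surv ω} ≠ 0) :
    Integrable (fun ω => (rise ω : ℝ)) (survLaw p) := by
  have := isProbabilityMeasure_survLaw hθ
  set m := ∫ ω, (gap ω : ℝ) ∂survLaw p
  set c := ∫ ω, (run ω : ℝ) ∂percLaw p
  have hmeas : Measurable fun ω => (rise ω).toNat :=
    (measurable_from_top (f := Int.toNat)).comp measurable_rise
  have hmeasK : ∀ K : ℕ, Measurable fun ω => min (rise ω).toNat K := fun K =>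
    (measurable_from_top (f := fun n : ℕ => min n K)).comp hmeas
  have hintK : ∀ K : ℕ, Integrable (fun ω => ((min (rise ω).toNat K : ℕ) : ℝ)) (survLaw p) := by
    intro K
    refine Integrable.of_bound (C := (K : ℝ))
      (measurable_from_top.comp (hmeasK K)).aestronglyMeasurable (ae_of_all _ fun ω => ?_)
    rw [Real.norm_of_nonneg (by positivity)]
    exact_mod_cast min_le_right _ _
  have hbound : ∀ K : ℕ, ∫ ω, ((min (rise ω).toNat K : ℕ) : ℝ) ∂survLaw p ≤ c * m := by
    intro K
    have hex := (strong_law_regen hp0 hp1 hθ (fun a => ((min a.2.toNat K : ℕ) : ℝ)) (hintK K)).and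
      ((tendsto_renTime hp0 hp1 hθ).and ((ae_iterate_regen hp0 hp1 hθ).and
        (ae_survLaw ((tendsto_runSum hp1).mono fun ω h _ => h))))
    -- The limits are deterministic, so comparing them in a single environment is enough.
    obtain ⟨ω, h1, h2, ⟨hgood, h3⟩, h4⟩ := hex.exists
    have hmono := strictMono_renTime fun i => (h3 i).2.1
    refine le_of_tendsto_of_tendsto h1 ((h4.comp hmono.tendsto_atTop).mul h2) ?_
    filter_upwards [eventually_gt_atTop 0] with n hn
    have hn' : (n : ℝ) ≠ 0 := by positivity
    have hT' : (renTime ω n : ℝ) ≠ 0 := by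
      have : 0 < renTime ω n := hn.trans_le (hmono.id_le n)
      positivity
    simp only [Function.comp]
    rw [div_mul_div_cancel₀ hT']
    refine div_le_div_of_nonneg_right ?_ (by positivity)
    have htop := (iterate_regen hgood (fun i => (h3 i).1) n).2
    have hle := hgood.top_le_runSum (renTime ω n)
    have hsum : (∑ i ∈ Finset.range n, ((min (rise (regen^[i] ω)).toNat K : ℕ) : ℤ)) ≤
        ∑ i ∈ Finset.range n, rise (regen^[i] ω) :=
      Finset.sum_le_sum fun i _ => by
        have := (h3 i).2.2
        lia
    rw [← htop] at hsum
    exact_mod_cast hsum.trans hle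
  have hnat : Integrable (fun ω => ((rise ω).toNat : ℝ)) (survLaw p) := by
    refine integrable_natCast_of_lintegral hmeas
      (lt_of_le_of_lt (ENNReal.tsum_le_of_sum_range_le (c := ENNReal.ofReal (c * m)) fun K => ?_)
        ENNReal.ofReal_lt_top)
    calc ∑ k ∈ Finset.range K, survLaw p {ω | k < (rise ω).toNat}
        = ∑ k ∈ Finset.range K, survLaw p {ω | k < min (rise ω).toNat K} := by
          refine Finset.sum_congr rfl fun k hk => ?_
          simp [Finset.mem_range.1 hk]
      _ ≤ ∑' k, survLaw p {ω | k < min (rise ω).toNat K} := ENNReal.sum_le_tsum _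
      _ = ∫⁻ ω, ((min (rise ω).toNat K : ℕ) : ENNReal) ∂survLaw p :=
          (lintegral_natCast_eq_tsum _ (hmeasK K)).symm
      _ = ENNReal.ofReal (∫ ω, ((min (rise ω).toNat K : ℕ) : ℝ) ∂survLaw p) := by
          rw [ofReal_integral_eq_lintegral_ofReal (hintK K) (ae_of_all _ fun ω => by positivity)]
          simp only [ENNReal.ofReal_natCast]
      _ ≤ _ := ENNReal.ofReal_le_ofReal (hbound K)
  refine hnat.congr ?_
  filter_upwards [ae_iterate_regen hp0 hp1 hθ] with ω hω
  have h : 0 ≤ rise ω := (hω.2 0).2.2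
  have h' : ((rise ω).toNat : ℤ) = rise ω := Int.toNat_of_nonneg h
  exact_mod_cast congrArg (Int.cast : ℤ → ℝ) h'

/-- On survival, the highest entry points have an asymptotic slope. -/
theorem exists_slope (hp0 : 0 < p) (hp1 : p < 1) (hθ : percLaw p {ω | Surv ω} ≠ 0) :
    ∃ l : ℝ, 0 ≤ l ∧ ∀ᵐ ω ∂percLaw p, Surv ω →
      Tendsto (fun n : ℕ => (top ω n : ℝ) / n) atTop (𝓝 l) := by
  have := isProbabilityMeasure_survLaw hθ
  have key : ∀ᵐ ω ∂survLaw p, Tendsto (fun n : ℕ => (top ω n : ℝ) / n) atTop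
      (𝓝 ((∫ ω, (rise ω : ℝ) ∂survLaw p) / ∫ ω, (gap ω : ℝ) ∂survLaw p)) := by
    filter_upwards [strong_law_regen hp0 hp1 hθ (fun a => (a.2 : ℝ)) (integrable_rise hp0 hp1 hθ),
      tendsto_renTime hp0 hp1 hθ, ae_iterate_regen hp0 hp1 hθ,
      ae_survLaw ((tendsto_runSum hp1).mono fun ω h _ => h)] with ω h1 h2 h3 h4
    obtain ⟨hgood, h3⟩ := h3
    have hit := iterate_regen hgood fun i => (h3 i).1
    refine tendsto_div_of_subsequence (strictMono_renTime fun i => (h3 i).2.1) (by simp [renTime])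
      (integral_gap_pos hp0 hp1 hθ) h2 (a := fun n => (top ω n : ℝ))
      (s := fun n => (runSum ω n : ℝ)) ?_ h4 ?_ ?_
    · refine h1.congr fun n => ?_
      rw [(hit n).2]
      push_cast
      rfl
    · intro k n hkn
      obtain ⟨d, rfl⟩ := Nat.exists_eq_add_of_le hkn
      have hs := (h3 k).1
      rw [(hit k).1] at hs
      have h5 : top ω (renTime ω k + d) = _ := hgood.top_add (hs d)
      have h6 := (hgood.shifted _ _).top_nonneg (hs d)
      have : top ω (renTime ω k) ≤ top ω (renTime ω k + d) := by lia
      exact_mod_cast this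
    · intro k n hkn
      have := hgood.top_le_add_runSum hkn
      have h' : (top ω n : ℝ) + runSum ω (renTime ω k) ≤ top ω (renTime ω k) + runSum ω n := by
        exact_mod_cast this
      linarith
  refine ⟨_, ?_, ae_of_ae_survLaw key⟩
  refine div_nonneg (integral_nonneg_of_ae ?_) (integral_gap_pos hp0 hp1 hθ).le
  filter_upwards [ae_iterate_regen hp0 hp1 hθ] with ω hω
  have h : 0 ≤ rise ω := (hω.2 0).2.2
  exact Int.cast_nonneg h

end Slope

/-! ### Mean heights against the almost sure slope. -/

section MeanHeight

variable {p : unitInterval}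

/-- The mean height of the highest entry point into column `n`. -/
noncomputable def meanTop (p : unitInterval) (n : ℕ) : ℝ := ∫ ω, (top ω n : ℝ) ∂percLaw p

lemma Good.top_mul_le {ω : Env Bool} (h : Good ω) (k n : ℕ) :
    top ω (n * k) ≤ ∑ i ∈ Finset.range n, top (fromTop (i * k) ω) k := by
  induction n with
  | zero => simp
  | succ n ih =>
    rw [Finset.sum_range_succ, add_mul, one_mul]
    have := h.top_add_le (n * k) k
    rw [← fromTop] at this
    lia

/-- Iterated subadditivity bounds `top` at multiples of `k` by a sum of i.i.d. copies of `top ω k`.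
The two growth rates are compared in one surviving environment. -/
lemma slope_mul_le_meanTop (hp0 : 0 < p) (hp1 : p < 1) (hθ : percLaw p {ω | Surv ω} ≠ 0) {l : ℝ}
    (hl : ∀ᵐ ω ∂percLaw p, Surv ω → Tendsto (fun n : ℕ => (top ω n : ℝ) / n) atTop (𝓝 l))
    {k : ℕ} (hk : 0 < k) : l * k ≤ meanTop p k := by
  have := isProbabilityMeasure_survLaw hθ
  have h := (ae_survLaw hl).and ((ae_survLaw ((ae_good hp0 hp1).mono fun ω h _ => h)).and
    (ae_survLaw ((strong_law_fromTop p (k := k) (measurable_top_real k)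
      (fun _ _ h => by simp only [dependsOn_top k h])
      (integrable_top hp0 hp1 k)).mono fun ω h _ => h)))
  obtain ⟨ω, h1, h2, h3⟩ := h.exists
  have hnk : Tendsto (fun n : ℕ => n * k) atTop atTop := tendsto_id.atTop_mul_const' hk
  refine le_of_tendsto_of_tendsto' ((h1.comp hnk).mul_const (k : ℝ)) h3 fun n => ?_
  have hle : (top ω (n * k) : ℝ) ≤ ∑ i ∈ Finset.range n, (top (fromTop (i * k) ω) k : ℝ) := by
    exact_mod_cast h2.top_mul_le k n
  have hk' : (k : ℝ) ≠ 0 := by positivity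
  simp only [Function.comp]
  push_cast
  rw [div_mul_eq_mul_div, mul_div_mul_right _ _ hk']
  exact div_le_div_of_nonneg_right hle (by positivity)

/-- A regeneration anywhere suffices. `exists_meanTop_div_le` works on the event of regeneration at
column `n`, where the origin itself need not survive. -/
lemma tendsto_top_of_ren (hp0 : 0 < p) (hp1 : p < 1) {l : ℝ}
    (hl : ∀ᵐ ω ∂percLaw p, Surv ω → Tendsto (fun n : ℕ => (top ω n : ℝ) / n) atTop (𝓝 l)) :
    ∀ᵐ ω ∂percLaw p, (∃ j, Ren ω j) →
      Tendsto (fun n : ℕ => (top ω n : ℝ) / n) atTop (𝓝 l) := by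
  have h := ae_all_iff.2 fun j => (measurePreserving_fromTop p j).quasiMeasurePreserving.ae hl
  filter_upwards [h, ae_good hp0 hp1] with ω h1 h2
  rintro ⟨j, hj⟩
  have h3 := h1 j hj
  rw [← tendsto_add_atTop_iff_nat j]
  have hc : Tendsto (fun n : ℕ => (n : ℝ) / ((n + j : ℕ) : ℝ)) atTop (𝓝 1) := by
    have := tendsto_natCast_div_add_atTop (𝕜 := ℝ) (j : ℝ)
    simpa using this
  have hz : Tendsto (fun n : ℕ => (top ω j : ℝ) / ((n + j : ℕ) : ℝ)) atTop (𝓝 0) :=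
    (tendsto_const_nhds.div_atTop (tendsto_natCast_atTop_atTop.comp (tendsto_add_atTop_nat j)))
  have h4 := hz.add (h3.mul hc)
  rw [zero_add, mul_one] at h4
  refine h4.congr' ?_
  filter_upwards [eventually_gt_atTop 0] with n hn
  have hn' : (n : ℝ) ≠ 0 := by positivity
  rw [add_comm n j, h2.top_add (hj n), div_mul_div_cancel₀ hn', ← add_div, fromTop]
  push_cast
  rfl

/-- The nonnegative deficit `f n = (runSum - top) / n` depends on the first `n` columns, hence is
independent of regeneration at `n`, an event of probability `θ`. On that event `f n` is at least `c
- l` minus a shortfall `h n` of vanishing mean. Dividing by `θ` bounds the unconditional mean of `f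
n` from below, that is, `meanTop` from above. -/
lemma exists_meanTop_div_le (hp0 : 0 < p) (hp1 : p < 1) (hθ : percLaw p {ω | Surv ω} ≠ 0) {l : ℝ}
    (hl : ∀ᵐ ω ∂percLaw p, Surv ω → Tendsto (fun n : ℕ => (top ω n : ℝ) / n) atTop (𝓝 l)) :
    ∃ e : ℕ → ℝ, Tendsto e atTop (𝓝 0) ∧ ∀ n, 0 < n → meanTop p n / n ≤ l + e n := by
  set c := ∫ ω, (run ω : ℝ) ∂percLaw p
  let f : ℕ → Env Bool → ℝ := fun n ω => (runSum ω n - top ω n) / n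
  have hfm : ∀ n, Measurable (f n) := fun n =>
    ((measurable_from_top.comp (measurable_runSum n) : Measurable fun ω => (runSum ω n : ℝ)).sub
      (measurable_top_real n)).div_const _
  have hfint : ∀ n, Integrable (f n) (percLaw p) := fun n =>
    ((integrable_runSum hp1 n).sub (integrable_top hp0 hp1 n)).div_const _
  have hfdep : ∀ n, DependsOn (f n) (before n) := by
    intro n ω ω' h
    simp only [f, show top ω n = top ω' n from dependsOn_top n h,
      show runSum ω n = runSum ω' n from dependsOn_runSum n h]
  have hfnn : ∀ᵐ ω ∂percLaw p, ∀ n, 0 ≤ f n ω := by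
    filter_upwards [ae_good hp0 hp1] with ω hω n
    have : (top ω n : ℝ) ≤ runSum ω n := by exact_mod_cast hω.top_le_runSum n
    exact div_nonneg (by linarith) (by positivity)
  have hflim : ∀ᵐ ω ∂percLaw p, (∃ j, Ren ω j) → Tendsto (fun n => f n ω) atTop (𝓝 (c - l)) := by
    filter_upwards [tendsto_top_of_ren hp0 hp1 hl, tendsto_runSum hp1] with ω h1 h2 h3
    refine (h2.sub (h1 h3)).congr fun n => ?_
    rw [← sub_div]
  let A : Set (Env Bool) := {ω | ∃ j, Ren ω j}
  have hA : MeasurableSet A := measurableSet_setOfPred.2 (Measurable.exists measurable_ren)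
  -- As `f n ≥ 0`, the shortfall is at most `|c - l|`, so dominated convergence applies without
  -- uniform integrability of `top`.
  let h : ℕ → Env Bool → ℝ := fun n => A.indicator fun ω => max (c - l - f n ω) 0
  have hhm : ∀ n, Measurable (h n) := fun n =>
    ((measurable_const.sub (hfm n)).max measurable_const).indicator hA
  have hh0 : ∀ n ω, 0 ≤ h n ω := fun n ω => Set.indicator_nonneg (fun _ _ => le_max_right _ _) ω
  have hhb : ∀ n, ∀ᵐ ω ∂percLaw p, ‖h n ω‖ ≤ |c - l| := by
    intro n
    filter_upwards [hfnn] with ω hω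
    rw [Real.norm_of_nonneg (hh0 n ω)]
    refine Set.indicator_apply_le' (fun _ => max_le ?_ (abs_nonneg _)) (fun _ => abs_nonneg _)
    have := hω n
    have := le_abs_self (c - l)
    linarith
  have hhlim : Tendsto (fun n => ∫ ω, h n ω ∂percLaw p) atTop (𝓝 0) := by
    have := tendsto_integral_of_dominated_convergence (μ := percLaw p) (F := h)
      (f := fun _ => (0 : ℝ)) (fun _ => |c - l|) (fun n => (hhm n).aestronglyMeasurable)
      (integrable_const _) hhb ?_
    · simpa using this
    · filter_upwards [hflim] with ω hω
      by_cases hωA : ω ∈ A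
      · have h1 := ((tendsto_const_nhds (x := c - l)).sub (hω hωA)).max
          (tendsto_const_nhds (x := (0 : ℝ)))
        rw [sub_self, max_self] at h1
        refine h1.congr fun n => ?_
        exact (Set.indicator_of_mem hωA fun ω => max (c - l - f n ω) 0).symm
      · refine (tendsto_const_nhds (x := (0 : ℝ))).congr fun n => ?_
        exact (Set.indicator_of_notMem (M := ℝ) hωA _).symm
  have hhint : ∀ n, Integrable (h n) (percLaw p) := fun n =>
    Integrable.of_bound (hhm n).aestronglyMeasurable _ (hhb n)
  set θ := (percLaw p).real {ω | Surv ω} with hθdef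
  have hθ0 : 0 < θ := ENNReal.toReal_pos hθ (measure_ne_top _ _)
  let g : Env Bool → ℝ := Set.indicator {ω | Surv ω} 1
  have hg : Measurable g := measurable_one.indicator measurableSet_surv
  have hgint : ∫ ω, g ω ∂percLaw p = θ := integral_indicator_one measurableSet_surv
  refine ⟨fun n => (∫ ω, h n ω ∂percLaw p) / θ, by simpa using hhlim.div_const θ, fun n hn => ?_⟩
  have hn' : (n : ℝ) ≠ 0 := by positivity
  have hgint' : ∫ ω, g (fromTop n ω) ∂percLaw p = θ := by
    rw [integral_comp_measurePreserving (measurePreserving_fromTop p n) hg, hgint]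
  have hind : ∫ ω, f n ω * g (fromTop n ω) ∂percLaw p = (∫ ω, f n ω ∂percLaw p) * θ := by
    rw [← hgint']
    exact IndepFun.integral_fun_mul_eq_mul_integral
      ((indepFun_restart _ (measurable_top n) (dependsOn_top n) (hfm n) (hfdep n)).comp
        measurable_id hg) (hfm n).aestronglyMeasurable
      (hg.comp (measurable_fromTop n)).aestronglyMeasurable
  have hfi : ∫ ω, f n ω ∂percLaw p = c - meanTop p n / n := by
    simp only [f]
    rw [integral_div, integral_sub (integrable_runSum hp1 n) (integrable_top hp0 hp1 n),
      integral_runSum hp1, ← meanTop, sub_div, mul_div_cancel_left₀ _ hn']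
  have hgi : Integrable (fun ω => g (fromTop n ω)) (percLaw p) :=
    (measurePreserving_fromTop p n).integrable_comp_of_integrable
      ((integrable_const (1 : ℝ)).indicator measurableSet_surv)
  have hle : ∫ ω, ((c - l) * g (fromTop n ω) - h n ω) ∂percLaw p ≤
      ∫ ω, f n ω * g (fromTop n ω) ∂percLaw p := by
    refine integral_mono_ae ((hgi.const_mul _).sub (hhint n)) ?_ ?_
    · refine (hfint n).mul_bdd (c := 1) (hg.comp (measurable_fromTop n)).aestronglyMeasurable
        (ae_of_all _ fun ω => ?_)
      exact (norm_indicator_le_norm_self _ _).trans (by simp)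
    · refine ae_of_all _ fun ω => ?_
      by_cases hr : Ren ω n
      · have h1 : g (fromTop n ω) = 1 :=
          Set.indicator_of_mem (s := {ω | Surv ω}) (a := fromTop n ω) hr 1
        have h2 : h n ω = max (c - l - f n ω) 0 :=
          Set.indicator_of_mem (s := A) ⟨n, hr⟩ _
        simp only [h1, h2, mul_one]
        have := le_max_left (c - l - f n ω) 0
        linarith
      · have h1 : g (fromTop n ω) = 0 :=
          Set.indicator_of_notMem (s := {ω | Surv ω}) (a := fromTop n ω) hr 1
        simp only [h1, mul_zero]
        have := hh0 n ω
        linarith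
  rw [integral_sub (hgi.const_mul _) (hhint n), integral_const_mul, hgint', hind, hfi] at hle
  rw [← sub_le_iff_le_add', le_div_iff₀ hθ0]
  linarith

end MeanHeight

/-! ### Coupling of densities and strict monotonicity of the slope. -/

section Coupling

/-- Environments at all densities, driven by common labels: `i` is occupied at density `r i` when
its label is at most `r i`. -/
noncomputable def threshold (r : ℕ × ℤ → unitInterval) (U : Env unitInterval) : Env Bool :=
  fun i => decide (U i ≤ r i)

/-- The law of independent uniform labels. -/
noncomputable abbrev labelLaw : Measure (Env unitInterval) := envLaw volume

lemma preimage_decide_le (p : unitInterval) :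
    (fun u : unitInterval => decide (u ≤ p)) ⁻¹' {true} = Set.Iic p := by ext; simp

lemma measurable_decide_le (p : unitInterval) :
    Measurable fun u : unitInterval => decide (u ≤ p) :=
  measurable_to_bool (by rw [preimage_decide_le]; exact measurableSet_Iic)

lemma measurable_threshold (r : ℕ × ℤ → unitInterval) : Measurable (threshold r) := by
  refine measurable_pi_lambda _ fun i => ?_
  exact (measurable_decide_le (r i)).comp (measurable_pi_apply i)

lemma map_decide_le (p : unitInterval) :
    (volume : Measure unitInterval).map (fun u => decide (u ≤ p)) =
      bernoulliMeasure true false p := by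
  have h2 : (fun u : unitInterval => decide (u ≤ p)) ⁻¹' {false} = Set.Ioi p := by ext; simp
  refine Measure.ext_of_singleton fun b => ?_
  rw [Measure.map_apply (measurable_decide_le p) (measurableSet_singleton b)]
  cases b
  · rw [h2, unitInterval.volume_Ioi, bernoulliMeasure_apply p (measurableSet_singleton _)]
    have : (1 - (p : ℝ)).toNNReal = unitInterval.toNNReal (unitInterval.symm p) :=
      NNReal.eq (by rw [Real.coe_toNNReal _ (by linarith [p.2.2])]; simp)
    simp [ENNReal.ofReal, this]
  · rw [preimage_decide_le, unitInterval.volume_Iic,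
      bernoulliMeasure_apply p (measurableSet_singleton _)]
    have : (p : ℝ).toNNReal = unitInterval.toNNReal p :=
      NNReal.eq (by rw [Real.coe_toNNReal _ p.2.1]; simp)
    simp [ENNReal.ofReal, this]

lemma measurePreserving_threshold (p : unitInterval) :
    MeasurePreserving (threshold fun _ => p) labelLaw (percLaw p) := by
  refine ⟨measurable_threshold _, ?_⟩
  have := Measure.infinitePi_map_pi (fun _ : ℕ × ℤ => (volume : Measure unitInterval))
    (f := fun _ u => decide (u ≤ p)) fun _ => measurable_decide_le p
  rw [map_decide_le] at this
  exact this

lemma threshold_mono {r r' : ℕ × ℤ → unitInterval} (h : ∀ i, r i ≤ r' i) (U : Env unitInterval)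
    (i : ℕ × ℤ) (hi : threshold r U i = true) : threshold r' U i = true := by
  simp only [threshold, decide_eq_true_eq] at hi ⊢
  exact hi.trans (h i)

variable {p q : unitInterval}

lemma Surv.mono {ω ω' : Env Bool} (h : ∀ i, ω i = true → ω' i = true) (hs : Surv ω) : Surv ω' :=
  fun n => (hs n).mono (entry_mono_env h subset_rfl n)

lemma percLaw_surv_mono (hqp : q ≤ p) : percLaw q {ω | Surv ω} ≤ percLaw p {ω | Surv ω} := by
  rw [← (measurePreserving_threshold q).measure_preimage measurableSet_surv.nullMeasurableSet,
    ← (measurePreserving_threshold p).measure_preimage measurableSet_surv.nullMeasurableSet]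
  exact measure_mono fun U hU => Surv.mono (threshold_mono (fun _ => hqp) U) hU

/-- Density `p` in the first `k` columns and `q` in the others. -/
def mixed (p q : unitInterval) (k : ℕ) (i : ℕ × ℤ) : unitInterval := if i.1 < k then p else q

lemma good_mixed (hqp : q ≤ p) {U : Env unitInterval} (hp : Good (threshold (fun _ => p) U))
    (hq : Good (threshold (fun _ => q) U)) (k : ℕ) : Good (threshold (mixed p q k) U) := by
  intro n b
  constructor
  · by_cases hn : n < k
    · simpa [threshold, mixed, hn] using (hp n b).1
    · simpa [threshold, mixed, hn] using (hq n b).1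
  · obtain ⟨y, hy, hr⟩ := (hq n b).2
    refine ⟨y, hy, fun i hi => threshold_mono (fun j => ?_) U (i, y) (hr i hi)⟩
    simp only [mixed]
    split_ifs
    exacts [hqp, le_rfl]

lemma mixed_le_mixed (hqp : q ≤ p) {k l : ℕ} (hkl : k ≤ l) (i : ℕ × ℤ) :
    mixed p q k i ≤ mixed p q l i := by
  simp only [mixed]
  split_ifs
  · exact le_rfl
  · lia
  · exact hqp
  · exact le_rfl

lemma Good.top_le_top {ω ω' : Env Bool} (h : Good ω) (h' : Good ω')
    (hle : ∀ i, ω i = true → ω' i = true) (n : ℕ) : top ω n ≤ top ω' n :=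
  (h'.isGreatest_entry_Iic n).2 (entry_mono_env hle subset_rfl n (h.isGreatest_entry_Iic n).1)

lemma shift_threshold_mixed {j k : ℕ} (hjk : j ≤ k) (y : ℤ) (U : Env unitInterval) :
    shift k y (threshold (mixed p q j) U) = threshold (fun _ => q) (shift k y U) := by
  funext i
  have : ¬ i.1 + k < j := by lia
  simp only [shift, threshold]
  exact decide_eq_decide.2 (by simp [mixed, this])

lemma top_threshold_mixed {n k : ℕ} (hnk : n ≤ k) (U : Env unitInterval) :
    top (threshold (mixed p q k) U) n = top (threshold (fun _ => p) U) n := by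
  refine top_congr fun i hi => ?_
  have : i.1 < k := hi.trans_le hnk
  simp [threshold, mixed, this]

/-- The gain in column `m` from raising the half-line of starting points by one. -/
noncomputable def stepGain (m : ℕ) (ω : Env Bool) : ℤ := top ω m - top (shift 0 (-1) ω) m + 1

/-- If the origin does not reach column `m`, nothing is gained from it. -/
lemma Good.stepGain_nonpos {ω : Env Bool} (h : Good ω) {m : ℕ}
    (hne : ¬ (entry ω {0} m).Nonempty) : stepGain m ω ≤ 0 := by
  have h1 := (h.isGreatest_entry_Iic m).1
  have h2 : Set.Iic (0 : ℤ) = {0} ∪ Set.Iic (-1) := by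
    ext z
    simp only [Set.mem_Iic, Set.singleton_union, Set.mem_insert_iff]
    lia
  rw [h2, entry_union, Set.not_nonempty_iff_eq_empty.1 hne, Set.empty_union] at h1
  have h3 : top ω m + 1 ∈ entry (shift 0 (-1) ω) (Set.Iic 0) m :=
    mem_entry_shift_Iic.2 (by simpa using h1)
  have := ((h.shifted 0 (-1)).isGreatest_entry_Iic m).2 h3
  rw [stepGain]
  lia

/-- Raising the density in column `k` gains at least what is gained by raising the half-line, if it
raises the next highest entry point. -/
lemma stepGain_le (hqp : q ≤ p) {U : Env unitInterval} (hp : Good (threshold (fun _ => p) U))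
    (hq : Good (threshold (fun _ => q) U)) {k m : ℕ}
    (hlt : top (threshold (mixed p q k) U) (k + 1) < top (threshold (fun _ => p) U) (k + 1)) :
    stepGain m (threshold (fun _ => q)
        (shift (k + 1) (top (threshold (fun _ => p) U) (k + 1)) U)) ≤
      top (threshold (mixed p q (k + 1)) U) (k + 1 + m) -
        top (threshold (mixed p q k) U) (k + 1 + m) := by
  have hg := good_mixed hqp hp hq k
  have hg' := good_mixed hqp hp hq (k + 1)
  have htop := top_threshold_mixed (p := p) (q := q) (le_refl (k + 1)) U
  rw [← htop] at hlt ⊢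
  set ω := threshold (mixed p q k) U
  set ω' := threshold (mixed p q (k + 1)) U
  have hsh : ∀ y, threshold (fun _ => q) (shift (k + 1) y U) = shift (k + 1) y ω' :=
    fun y => (shift_threshold_mixed le_rfl y U).symm
  have hsh' : ∀ y, shift (k + 1) y ω' = shift (k + 1) y ω := fun y =>
    (shift_threshold_mixed le_rfl y U).trans (shift_threshold_mixed (Nat.le_succ k) y U).symm
  rw [hsh]
  -- If the raised top dies out before the final column, the step gain is nonpositive and
  -- monotonicity in the density is enough.
  by_cases hne : (entry (shift (k + 1) (top ω' (k + 1)) ω') {0} m).Nonempty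
  · have h1 := hg'.top_add hne
    -- By `hlt`, at the lower density all entries into column `k + 1` lie at least one below the
    -- raised top, and from there on both environments agree.
    have h2 := hg.top_add_le_of_le (k := k + 1) (b := top ω' (k + 1) - 1) (by lia) m
    have h3 : shift 0 (-1) (shift (k + 1) (top ω' (k + 1)) ω') =
        shift (k + 1) (top ω' (k + 1) - 1) ω := by
      rw [shift_shift, hsh']
      rfl
    rw [stepGain, h3]
    lia
  · have h1 := (hg'.shifted (k + 1) (top ω' (k + 1))).stepGain_nonpos hne
    have h2 := hg.top_le_top hg' (threshold_mono (mixed_le_mixed hqp (Nat.le_succ k)) U) (k + 1 + m)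
    lia

/-- A site at the highest entry point that is only occupied at the higher density raises the next
highest entry point. -/
lemma top_lt_top_of_mem_Ioc (hqp : q ≤ p) {U : Env unitInterval}
    (hp : Good (threshold (fun _ => p) U)) (hq : Good (threshold (fun _ => q) U)) {k : ℕ}
    (hU : U (k, top (threshold (fun _ => p) U) k) ∈ Set.Ioc q p) :
    top (threshold (mixed p q k) U) (k + 1) < top (threshold (fun _ => p) U) (k + 1) := by
  have hg := good_mixed hqp hp hq k
  have htop := top_threshold_mixed (p := p) (q := q) (le_refl k) U
  have h1 : top (threshold (fun _ => p) U) k + 1 ≤ top (threshold (fun _ => p) U) (k + 1) := by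
    refine (hp.isGreatest_entry_Iic (k + 1)).2 ⟨_, (hp.isGreatest_entry_Iic k).1, _, le_rfl,
      fun u h1 h2 => ?_, Or.inr rfl⟩
    rw [le_antisymm h2 h1]
    simpa [threshold] using hU.2
  have h2 : top (threshold (mixed p q k) U) (k + 1) ≤ top (threshold (fun _ => p) U) k := by
    obtain ⟨e, he, y, hy, hr, hz⟩ := (hg.isGreatest_entry_Iic (k + 1)).1
    have h3 := (hg.isGreatest_entry_Iic k).2 he
    rw [htop] at h3
    by_contra hlt
    have h4 := hr (top (threshold (fun _ => p) U) k) h3 (by lia)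
    simp only [threshold, mixed, lt_irrefl, if_false, decide_eq_true_eq] at h4
    exact absurd h4 (not_le.2 hU.1)
  lia

lemma measurable_stepGain (m : ℕ) : Measurable fun ω => (stepGain m ω : ℝ) := by
  have : Measurable fun ω => stepGain m ω :=
    ((measurable_top m).sub ((measurable_top m).comp (measurable_shift 0 (-1)))).add_const 1
  exact measurable_from_top.comp this

lemma integrable_stepGain (hq0 : 0 < q) (hq1 : q < 1) (m : ℕ) :
    Integrable (fun ω => (stepGain m ω : ℝ)) (percLaw q) := by
  have h := integrable_top hq0 hq1 m
  have h' := (measurePreserving_shift (bernoulliMeasure true false q) 0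
    (-1)).integrable_comp_of_integrable h
  refine ((h.sub h').add (integrable_const 1)).congr (ae_of_all _ fun ω => ?_)
  simp [stepGain]

/-- By vertical translation invariance the two tops have equal means and only the constant 1
remains, whatever the number `m` of columns. -/
lemma integral_stepGain (hq0 : 0 < q) (hq1 : q < 1) (m : ℕ) :
    ∫ ω, (stepGain m ω : ℝ) ∂percLaw q = 1 := by
  have h := integrable_top hq0 hq1 m
  have hmp := measurePreserving_shift (bernoulliMeasure true false q) 0 (-1)
  have h' : Integrable (fun ω => (top (shift 0 (-1) ω) m : ℝ)) (percLaw q) :=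
    hmp.integrable_comp_of_integrable h
  have heq := integral_comp_measurePreserving hmp (measurable_top_real m)
  simp only [stepGain, Int.cast_add, Int.cast_sub, Int.cast_one]
  rw [integral_add (f := fun ω => (top ω m : ℝ) - top (shift 0 (-1) ω) m) (h.sub h')
    (integrable_const 1), integral_sub h h', heq]
  simp

lemma ae_good_threshold (hp0 : 0 < p) (hp1 : p < 1) :
    ∀ᵐ U ∂labelLaw, Good (threshold (fun _ => p) U) :=
  (measurePreserving_threshold p).quasiMeasurePreserving.ae (ae_good hp0 hp1)

lemma measurable_top_threshold (r : ℕ × ℤ → unitInterval) (n : ℕ) :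
    Measurable fun U => top (threshold r U) n :=
  (measurable_top n).comp (measurable_threshold r)

lemma dependsOn_top_threshold (r : ℕ × ℤ → unitInterval) (n : ℕ) :
    DependsOn (fun U => top (threshold r U) n) (before n) :=
  fun U U' h => top_congr fun i hi => by simp only [threshold, h i hi]

lemma integrable_top_threshold (hp0 : 0 < p) (hp1 : p < 1) (n : ℕ) :
    Integrable (fun U => (top (threshold (fun _ => p) U) n : ℝ)) labelLaw :=
  (measurePreserving_threshold p).integrable_comp_of_integrable (integrable_top hp0 hp1 n)

/-- The mixed top lies between the tops at densities `q` and `p`. -/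
lemma integrable_top_mixed (hq0 : 0 < q) (hqp : q ≤ p) (hp1 : p < 1) (k n : ℕ) :
    Integrable (fun U => (top (threshold (mixed p q k) U) n : ℝ)) labelLaw := by
  have hp0 := hq0.trans_le hqp
  have hq1 := hqp.trans_lt hp1
  refine ((integrable_top_threshold hp0 hp1 n).abs.add
    (integrable_top_threshold hq0 hq1 n).abs).mono'
    (measurable_from_top.comp (measurable_top_threshold _ n)).aestronglyMeasurable ?_
  filter_upwards [ae_good_threshold hp0 hp1, ae_good_threshold hq0 hq1] with U hp hq
  have hg := good_mixed hqp hp hq k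
  have h1 : (top (threshold (fun _ => q) U) n : ℝ) ≤ top (threshold (mixed p q k) U) n := by
    refine Int.cast_le.2 (hq.top_le_top hg (threshold_mono (fun i => ?_) U) n)
    simp only [mixed]
    split_ifs
    exacts [hqp, le_rfl]
  have h2 : (top (threshold (mixed p q k) U) n : ℝ) ≤ top (threshold (fun _ => p) U) n := by
    refine Int.cast_le.2 (hg.top_le_top hp (threshold_mono (fun i => ?_) U) n)
    simp only [mixed]
    split_ifs
    exacts [le_rfl, hqp]
  simp only [Pi.add_apply, Real.norm_eq_abs]
  rw [abs_le]
  have h3 := neg_abs_le (top (threshold (fun _ => q) U) n : ℝ)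
  have h4 := le_abs_self (top (threshold (fun _ => p) U) n : ℝ)
  have h5 := abs_nonneg (top (threshold (fun _ => q) U) n : ℝ)
  have h6 := abs_nonneg (top (threshold (fun _ => p) U) n : ℝ)
  constructor <;> linarith

/-- The top of column `k` is determined by earlier columns, so the label at that site is still
uniform and falls in `(q, p]` with probability `p - q`. -/
lemma measure_raise_ge (hq0 : 0 < q) (hqp : q ≤ p) (hp1 : p < 1) (k : ℕ) :
    (p : ℝ) - q ≤ (labelLaw).real {U | top (threshold (mixed p q k) U) (k + 1) <
      top (threshold (fun _ => p) U) (k + 1)} := by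
  have hp0 := hq0.trans_le hqp
  have hq1 := hqp.trans_lt hp1
  let C : Set (Env unitInterval) := (fun V => V (0, 0)) ⁻¹' Set.Ioc q p
  have hC : MeasurableSet C := measurable_pi_apply _ measurableSet_Ioc
  have hCm : labelLaw C = ENNReal.ofReal (p - q) := by
    rw [← unitInterval.volume_Ioc]
    exact (measurePreserving_eval_infinitePi (fun _ : ℕ × ℤ => (volume : Measure unitInterval))
      (0, 0)).measure_preimage measurableSet_Ioc.nullMeasurableSet
  have hmp := measurePreserving_restart (volume : Measure unitInterval)
    (measurable_top_threshold (fun _ => p) k) (dependsOn_top_threshold (fun _ => p) k)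
  rw [measureReal_def, ← ENNReal.ofReal_le_iff_le_toReal (measure_ne_top _ _), ← hCm,
    ← hmp.measure_preimage hC.nullMeasurableSet]
  refine measure_mono_ae ?_
  filter_upwards [ae_good_threshold hp0 hp1, ae_good_threshold hq0 hq1] with U hp hq hU
  refine top_lt_top_of_mem_Ioc hqp hp hq ?_
  have h : shift k (top (threshold (fun _ => p) U) k) U (0, 0) ∈ Set.Ioc q p := hU
  simpa [shift] using h

/-- On the event `J` that the next top is raised, the gain is at least a step gain of mean 1
computed from later columns, hence independent of `J`; off `J` it is nonnegative. So the mean gain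
is at least the probability of `J`. -/
lemma integral_top_mixed_succ (hq0 : 0 < q) (hqp : q ≤ p) (hp1 : p < 1) (k m : ℕ) :
    ∫ U, (top (threshold (mixed p q k) U) (k + 1 + m) : ℝ) ∂labelLaw + (p - q) ≤
      ∫ U, (top (threshold (mixed p q (k + 1)) U) (k + 1 + m) : ℝ) ∂labelLaw := by
  have hp0 := hq0.trans_le hqp
  have hq1 := hqp.trans_lt hp1
  let N : Env unitInterval → ℤ := fun U => top (threshold (fun _ => p) U) (k + 1)
  have hN : Measurable N := measurable_top_threshold _ _
  have hNk : DependsOn N (before (k + 1)) := dependsOn_top_threshold _ _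
  let J : Set (Env unitInterval) := {U | top (threshold (mixed p q k) U) (k + 1) < N U}
  have hJ : MeasurableSet J := measurableSet_lt (measurable_top_threshold _ _) hN
  let j : Env unitInterval → ℝ := J.indicator 1
  have hj : Measurable j := measurable_one.indicator hJ
  have hjk : DependsOn j (before (k + 1)) := by
    intro U U' h
    have h1 : top (threshold (mixed p q k) U) (k + 1) = top (threshold (mixed p q k) U') (k + 1) :=
      dependsOn_top_threshold _ _ h
    have h2 : U ∈ J ↔ U' ∈ J := by
      simp only [J, Set.mem_ofPred_eq, h1, show N U = N U' from hNk h]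
    by_cases hU : U ∈ J
    · simp only [j, Set.indicator_of_mem hU, Set.indicator_of_mem (h2.1 hU), Pi.one_apply]
    · simp only [j, Set.indicator_of_notMem hU, Set.indicator_of_notMem (fun h' => hU (h2.2 h'))]
  let D : Env unitInterval → ℝ := fun U => (stepGain m (threshold (fun _ => q) U) : ℝ)
  have hD : Measurable D := (measurable_stepGain m).comp (measurable_threshold _)
  have hDi : Integrable D labelLaw :=
    (measurePreserving_threshold q).integrable_comp_of_integrable (integrable_stepGain hq0 hq1 m)
  have hD1 : ∫ U, D U ∂labelLaw = 1 := by
    rw [integral_comp_measurePreserving (measurePreserving_threshold q) (measurable_stepGain m),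
      integral_stepGain hq0 hq1]
  have hmp := measurePreserving_restart (volume : Measure unitInterval) hN hNk
  have hind : ∫ U, j U * D (shift (k + 1) (N U) U) ∂labelLaw = labelLaw.real J := by
    have h1 := IndepFun.integral_fun_mul_eq_mul_integral
      ((indepFun_restart (volume : Measure unitInterval) hN hNk hj hjk).comp measurable_id hD)
      hj.aestronglyMeasurable (hD.comp hmp.measurable).aestronglyMeasurable
    have h2 : ∫ U, D (shift (k + 1) (N U) U) ∂labelLaw = 1 := by
      rw [integral_comp_measurePreserving hmp hD, hD1]
    have h3 : ∫ U, j U ∂labelLaw = labelLaw.real J := integral_indicator_one hJ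
    refine h1.trans ?_
    change (∫ U, j U ∂labelLaw) * (∫ U, D (shift (k + 1) (N U) U) ∂labelLaw) = _
    rw [h2, h3, mul_one]
  have hjD : Integrable (fun U => j U * D (shift (k + 1) (N U) U)) labelLaw := by
    refine (hmp.integrable_comp_of_integrable hDi).bdd_mul (c := 1) hj.aestronglyMeasurable
      (ae_of_all _ fun U => ?_)
    exact (norm_indicator_le_norm_self _ _).trans (by simp)
  have hi := integrable_top_mixed hq0 hqp hp1 k (k + 1 + m)
  have hi' := integrable_top_mixed hq0 hqp hp1 (k + 1) (k + 1 + m)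
  have hle : ∫ U, j U * D (shift (k + 1) (N U) U) ∂labelLaw ≤
      ∫ U, ((top (threshold (mixed p q (k + 1)) U) (k + 1 + m) : ℝ) -
        top (threshold (mixed p q k) U) (k + 1 + m)) ∂labelLaw := by
    refine integral_mono_ae hjD (hi'.sub hi) ?_
    filter_upwards [ae_good_threshold hp0 hp1, ae_good_threshold hq0 hq1] with U hp hq
    by_cases hU : U ∈ J
    · have h1 := stepGain_le hqp hp hq (k := k) (m := m) hU
      have h2 : j U = 1 := Set.indicator_of_mem hU _
      rw [h2, one_mul]
      simp only [D, N]
      exact_mod_cast h1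
    · have h2 : j U = 0 := Set.indicator_of_notMem hU _
      rw [h2, zero_mul, sub_nonneg]
      exact Int.cast_le.2 ((good_mixed hqp hp hq k).top_le_top (good_mixed hqp hp hq (k + 1))
        (threshold_mono (mixed_le_mixed hqp (Nat.le_succ k)) U) (k + 1 + m))
  rw [hind, integral_sub hi' hi] at hle
  have := measure_raise_ge hq0 hqp hp1 k
  linarith

/-- The mean heights increase linearly with the density. -/
theorem meanTop_add_le (hq0 : 0 < q) (hqp : q ≤ p) (hp1 : p < 1) (n : ℕ) :
    meanTop q n + n * (p - q) ≤ meanTop p n := by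
  have key : ∀ k ≤ n, meanTop q n + k * (p - q) ≤
      ∫ U, (top (threshold (mixed p q k) U) n : ℝ) ∂labelLaw := by
    intro k
    induction k with
    | zero =>
      intro _
      have h : mixed p q 0 = fun _ => q := by funext i; simp [mixed]
      rw [h, integral_comp_measurePreserving (measurePreserving_threshold q) (measurable_top_real n)]
      simp [meanTop]
    | succ k ih =>
      intro hk
      obtain ⟨m, rfl⟩ := Nat.exists_eq_add_of_le hk
      have h1 := ih (by lia)
      have h2 := integral_top_mixed_succ hq0 hqp hp1 k m
      push_cast
      linarith
  refine (key n le_rfl).trans_eq ?_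
  simp only [top_threshold_mixed (le_refl n)]
  exact integral_comp_measurePreserving (measurePreserving_threshold p) (measurable_top_real n)

/-- The slope of the upper boundary is strictly increasing in the density. -/
theorem slope_add_le (hq0 : 0 < q) (hqp : q ≤ p) (hp1 : p < 1)
    (hθ : percLaw q {ω | Surv ω} ≠ 0) {l l' : ℝ}
    (hl : ∀ᵐ ω ∂percLaw q, Surv ω → Tendsto (fun n : ℕ => (top ω n : ℝ) / n) atTop (𝓝 l))
    (hl' : ∀ᵐ ω ∂percLaw p, Surv ω → Tendsto (fun n : ℕ => (top ω n : ℝ) / n) atTop (𝓝 l')) :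
    l + (p - q) ≤ l' := by
  have hθ' : percLaw p {ω | Surv ω} ≠ 0 := fun h => hθ (le_antisymm
    ((percLaw_surv_mono hqp).trans h.le) zero_le)
  obtain ⟨e, he, hle⟩ := exists_meanTop_div_le (hq0.trans_le hqp) hp1 hθ' hl'
  have hlim : Tendsto (fun n => l' + e n) atTop (𝓝 l') := by simpa using he.const_add l'
  refine ge_of_tendsto hlim ?_
  filter_upwards [eventually_gt_atTop 0] with n hn
  refine le_trans ?_ (hle n hn)
  have hn' : (0 : ℝ) < n := by positivity
  rw [le_div_iff₀ hn']
  have h1 := slope_mul_le_meanTop hq0 (hqp.trans_lt hp1) hθ hl hn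
  have h2 := meanTop_add_le hq0 hqp hp1 n
  linarith

end Coupling

/-! ### Back to the forward cluster: boundaries and the reflection symmetry. -/

section Cluster

/-- The part of a configuration that the cluster of the origin can see, with columns numbered from
right to left. -/
def toEnv (ω : Config) : Env Bool := fun i => ω (-(i.1 : ℤ), i.2)

lemma measurePreserving_toEnv (p : unitInterval) : MeasurePreserving toEnv (law p) (percLaw p) := by
  have hinj : Function.Injective fun i : ℕ × ℤ => ((-(i.1 : ℤ), i.2) : ℤ × ℤ) := by
    rintro ⟨a, b⟩ ⟨c, d⟩ h
    simpa using h
  exact ⟨measurable_pi_lambda _ fun _ => measurable_pi_apply _,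
    Measure.map_infinitePi_infinitePi_of_inj
      (P := fun _ : ℤ × ℤ => bernoulliMeasure true false p) hinj⟩

variable {ω : Config}

/-- A path never moves right or down, so its part in the last column is an occupied run above an
entry point. The endpoint itself may be vacant, hence the strict bound on `u`. -/
lemma exists_entry_of_mem {z : ℤ × ℤ} (h : z ∈ forwardCluster ω 0) :
    ∃ n : ℕ, z.1 = -(n : ℤ) ∧ ∃ e ∈ entry (toEnv ω) {0} n, e ≤ z.2 ∧
      ∀ u, e ≤ u → u < z.2 → toEnv ω (n, u) = true := by
  induction h with
  | refl => exact ⟨0, by simp, 0, rfl, le_rfl, fun u h1 h2 => absurd h1 (not_le.2 h2)⟩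
  | @tail b c _ hbc ih =>
    obtain ⟨n, hn, e, he, hle, hr⟩ := ih
    obtain ⟨hocc, hstep⟩ := hbc
    have hocc' : toEnv ω (n, b.2) = true := by rw [toEnv, ← hn]; exact hocc
    have hr' : ∀ u, e ≤ u → u ≤ b.2 → toEnv ω (n, u) = true := by
      intro u h1 h2
      rcases h2.lt_or_eq with h2 | rfl
      · exact hr u h1 h2
      · exact hocc'
    have hs : (c.1 - b.1 = -1 ∧ c.2 - b.2 = 0) ∨ (c.1 - b.1 = 0 ∧ c.2 - b.2 = 1) ∨
        (c.1 - b.1 = -1 ∧ c.2 - b.2 = 1) := by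
      simpa [steps, Prod.ext_iff] using hstep
    rcases hs with ⟨h1, h2⟩ | ⟨h1, h2⟩ | ⟨h1, h2⟩
    · refine ⟨n + 1, by push_cast; lia, c.2, ?_, le_rfl, fun u h1 h2 => absurd h1 (not_le.2 h2)⟩
      exact ⟨e, he, b.2, hle, hr', Or.inl (by lia)⟩
    · exact ⟨n, by lia, e, he, by lia, fun u h3 h4 => hr' u h3 (by lia)⟩
    · refine ⟨n + 1, by push_cast; lia, c.2, ?_, le_rfl, fun u h1 h2 => absurd h1 (not_le.2 h2)⟩
      exact ⟨e, he, b.2, hle, hr', Or.inr (by lia)⟩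

lemma mem_step {x y a b : ℤ} (h : (x, y) ∈ forwardCluster ω 0) (hocc : ω (x, y) = true)
    (hs : (a - x, b - y) ∈ steps) : (a, b) ∈ forwardCluster ω 0 :=
  Relation.ReflTransGen.tail h ⟨hocc, hs⟩

lemma mem_of_run {x e y : ℤ} (h : (x, e) ∈ forwardCluster ω 0) (hey : e ≤ y)
    (hr : ∀ u, e ≤ u → u < y → ω (x, u) = true) : (x, y) ∈ forwardCluster ω 0 := by
  induction y, hey using Int.leInduction with
  | base => exact h
  | succ y hy ih =>
    exact mem_step (ih fun u h1 h2 => hr u h1 (by lia)) (hr y hy (by lia)) (by simp [steps])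

lemma mem_of_entry {n : ℕ} {e : ℤ} (h : e ∈ entry (toEnv ω) {0} n) :
    (-(n : ℤ), e) ∈ forwardCluster ω 0 := by
  induction n generalizing e with
  | zero =>
    have : e = 0 := h
    subst this
    exact Relation.ReflTransGen.refl
  | succ n ih =>
    obtain ⟨e', he', y, hy, hr, hz⟩ := h
    have h1 : (-(n : ℤ), y) ∈ forwardCluster ω 0 :=
      mem_of_run (ih he') hy fun u h1 h2 => hr u h1 h2.le
    refine mem_step h1 (hr y hy le_rfl) ?_
    rcases hz with rfl | rfl <;> simp [steps]

lemma Good.le_top_add_topRun (hg : Good (toEnv ω)) {n : ℕ} {y : ℤ}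
    (h : (-(n : ℤ), y) ∈ forwardCluster ω 0) :
    y ≤ top (toEnv ω) n + topRun (toEnv ω) n := by
  obtain ⟨k, hk, e, he, hle, hr⟩ := exists_entry_of_mem h
  obtain rfl : n = k := by simpa using hk
  have h1 := (hg.isGreatest_entry_Iic n).2 (entry_mono (by simp) n he)
  by_contra hlt
  have := hr (top (toEnv ω) n + topRun (toEnv ω) n) (by lia) (not_le.1 hlt)
  simp [hg.topRun_spec] at this

lemma nonneg_of_mem {x y : ℤ} (h : (x, y) ∈ forwardCluster ω 0) : 0 ≤ y := by
  obtain ⟨k, -, e, he, hle, -⟩ := exists_entry_of_mem h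
  obtain ⟨a, rfl, ha⟩ := exists_le_of_mem_entry he
  exact ha.trans hle

/-- If column `n` is not entered, the cluster is confined to `n` columns, in each of which its
heights are bounded. -/
lemma Good.surv_of_infinite (hg : Good (toEnv ω)) (h : (forwardCluster ω 0).Infinite) :
    Surv (toEnv ω) := by
  intro n
  by_contra hn
  refine h (Set.Finite.subset (s := ⋃ k ∈ Set.Iio n, (fun y : ℤ => (-(k : ℤ), y)) ''
    Set.Icc 0 (top (toEnv ω) k + topRun (toEnv ω) k)) ?_ ?_)
  · exact (Set.finite_Iio n).biUnion fun k _ => (Set.finite_Icc _ _).image _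
  · rintro ⟨x, y⟩ hz
    obtain ⟨k, hk, e, he, -⟩ := exists_entry_of_mem hz
    simp only at hk
    subst hk
    simp only [Set.mem_iUnion]
    refine ⟨k, ?_, y, ⟨nonneg_of_mem hz, hg.le_top_add_topRun hz⟩, rfl⟩
    by_contra hkn
    exact hn (nonempty_of_le (not_lt.1 hkn) ⟨e, he⟩)

/-- A path from the origin passes through all columns in between. -/
lemma exists_mem_column {a m : ℤ} (h : (-a, m) ∈ forwardCluster ω 0) {n : ℕ} (hn : (n : ℤ) ≤ a) :
    ∃ y ≤ m, (-(n : ℤ), y) ∈ forwardCluster ω 0 := by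
  have key : ∀ z : ℤ × ℤ, z ∈ forwardCluster ω 0 → z.1 ≤ -(n : ℤ) →
      ∃ y ≤ z.2, (-(n : ℤ), y) ∈ forwardCluster ω 0 := by
    intro z hz
    induction hz with
    | refl =>
      intro h0
      have : n = 0 := by simpa using h0
      subst this
      exact ⟨0, le_rfl, Relation.ReflTransGen.refl⟩
    | @tail b c hb hbc ih =>
      intro hc
      have hs : (c.1 - b.1 = -1 ∧ c.2 - b.2 = 0) ∨ (c.1 - b.1 = 0 ∧ c.2 - b.2 = 1) ∨
          (c.1 - b.1 = -1 ∧ c.2 - b.2 = 1) := by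
        simpa [steps, Prod.ext_iff] using hbc.2
      by_cases hbn : b.1 ≤ -(n : ℤ)
      · obtain ⟨y, hy, hy'⟩ := ih hbn
        exact ⟨y, by lia, hy'⟩
      · have : c.1 = -(n : ℤ) := by lia
        refine ⟨c.2, le_rfl, ?_⟩
        rw [← this]
        exact Relation.ReflTransGen.tail hb hbc
  exact key (-a, m) h (by simpa using hn)

/-- The reflection exchanging the west and north steps. -/
def flip (z : ℤ × ℤ) : ℤ × ℤ := (-z.2, -z.1)

lemma flip_flip (z : ℤ × ℤ) : flip (flip z) = z := by simp [flip]

lemma flip_injective : Function.Injective flip :=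
  Function.LeftInverse.injective (g := flip) flip_flip

lemma measurePreserving_flip (p : unitInterval) :
    MeasurePreserving (fun ω : Config => fun z => ω (flip z)) (law p) (law p) :=
  ⟨measurable_pi_lambda _ fun _ => measurable_pi_apply _,
    Measure.map_infinitePi_infinitePi_of_inj
      (P := fun _ : ℤ × ℤ => bernoulliMeasure true false p) flip_injective⟩

lemma connected_flip {x y : ℤ × ℤ} (h : Connected ω x y) :
    Connected (fun z => ω (flip z)) (flip x) (flip y) := by
  refine Relation.ReflTransGen.lift flip ?_ _ _ h
  rintro ⟨a, b⟩ ⟨c, d⟩ ⟨h1, h2⟩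
  refine ⟨by simpa [flip_flip] using h1, ?_⟩
  simp only [steps, Set.mem_insert_iff, Set.mem_singleton_iff, Prod.mk_sub_mk, Prod.mk.injEq,
    flip] at h2 ⊢
  lia

lemma mem_forwardCluster_flip {z : ℤ × ℤ} :
    z ∈ forwardCluster (fun z => ω (flip z)) 0 ↔ flip z ∈ forwardCluster ω 0 := by
  have h0 : flip 0 = 0 := by simp [flip]
  constructor
  · intro h
    have := connected_flip h
    simp only [flip_flip, h0] at this
    exact this
  · intro h
    have := connected_flip h
    rwa [flip_flip, h0] at this

lemma infinite_forwardCluster_flip (h : (forwardCluster ω 0).Infinite) :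
    (forwardCluster (fun z => ω (flip z)) 0).Infinite := by
  refine (h.image flip_injective.injOn).mono ?_
  rintro _ ⟨z, hz, rfl⟩
  rw [mem_forwardCluster_flip, flip_flip]
  exact hz

/-- Existence of the slope of the upper boundary. -/
lemma exists_isGreatest_column {p : unitInterval} (hp0 : 0 < p) (hp1 : p < 1) {l : ℝ}
    (hl : ∀ᵐ η ∂percLaw p, Surv η → Tendsto (fun n : ℕ => (top η n : ℝ) / n) atTop (𝓝 l)) :
    ∀ᵐ ω ∂law p, (forwardCluster ω 0).Infinite → ∃ w : ℕ → ℤ,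
      (∀ n : ℕ, IsGreatest {x : ℤ | (-(n : ℤ), x) ∈ forwardCluster ω 0} (w n)) ∧
        Tendsto (fun n : ℕ => (w n : ℝ) / n) atTop (𝓝 l) := by
  have hq := (measurePreserving_toEnv p).quasiMeasurePreserving
  filter_upwards [hq.ae (ae_good hp0 hp1), hq.ae hl, hq.ae (tendsto_runSum hp1)]
    with ω hg h1 h2 hinf
  have hs := hg.surv_of_infinite hinf
  have hne : ∀ n : ℕ, top (toEnv ω) n ∈ {x : ℤ | (-(n : ℤ), x) ∈ forwardCluster ω 0} :=
    fun n => mem_of_entry (hg.top_mem_of_nonempty (hs n))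
  have hbd : ∀ n : ℕ, BddAbove {x : ℤ | (-(n : ℤ), x) ∈ forwardCluster ω 0} :=
    fun n => ⟨_, fun x hx => hg.le_top_add_topRun hx⟩
  have hgr : ∀ n : ℕ, IsGreatest {x : ℤ | (-(n : ℤ), x) ∈ forwardCluster ω 0}
      (sSup {x : ℤ | (-(n : ℤ), x) ∈ forwardCluster ω 0}) :=
    fun n => ⟨Int.csSup_mem ⟨_, hne n⟩ (hbd n), fun x hx => le_csSup (hbd n) hx⟩
  refine ⟨_, hgr, ?_⟩
  -- The `n`-th term of a sum whose averages converge is negligible relative to `n`.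
  have hrun : Tendsto (fun n : ℕ => (topRun (toEnv ω) n : ℝ) / n) atTop (𝓝 0) := by
    have h3 : Tendsto (fun n : ℕ => (runSum (toEnv ω) (n + 1) : ℝ) / n) atTop
        (𝓝 (∫ ω, (run ω : ℝ) ∂percLaw p)) := by
      have h4 := (h2.comp (tendsto_add_atTop_nat 1)).mul
        ((tendsto_const_nhds (x := (1 : ℝ))).add tendsto_one_div_atTop_nhds_zero_nat)
      rw [add_zero, mul_one] at h4
      refine h4.congr' ?_
      filter_upwards [eventually_gt_atTop 0] with k hk
      have : (k : ℝ) ≠ 0 := by positivity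
      simp only [Function.comp]
      push_cast
      field_simp
    have h5 := h3.sub h2
    rw [sub_self] at h5
    refine h5.congr fun n => ?_
    rw [runSum, runSum, Finset.sum_range_succ]
    push_cast
    ring
  have hup := (h1 hs).add hrun
  rw [add_zero] at hup
  refine tendsto_of_tendsto_of_tendsto_of_le_of_le (h1 hs) hup (fun n => ?_) (fun n => ?_)
  · exact div_le_div_of_nonneg_right (Int.cast_le.2 ((hgr n).2 (hne n))) (by positivity)
  · simp only
    rw [← add_div]
    refine div_le_div_of_nonneg_right ?_ (by positivity)
    exact_mod_cast hg.le_top_add_topRun (hgr n).1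

/-- If the rightmost points of the rows grow at rate `l`, then so does `n / v n` for the lowest
points `v n` of the columns. -/
lemma exists_isLeast_column {l : ℝ} {w a : ℕ → ℤ}
    (hw : ∀ n : ℕ, IsGreatest {x : ℤ | (-(n : ℤ), x) ∈ forwardCluster ω 0} (w n))
    (ha : ∀ m : ℕ, IsGreatest {x : ℤ | (-x, (m : ℤ)) ∈ forwardCluster ω 0} (a m))
    (hal : Tendsto (fun m : ℕ => (a m : ℝ) / m) atTop (𝓝 l)) :
    ∃ v : ℕ → ℕ, (∀ n : ℕ, IsLeast {x : ℤ | (-(n : ℤ), x) ∈ forwardCluster ω 0} (v n)) ∧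
      Tendsto v atTop atTop ∧ Tendsto (fun n : ℕ => (n : ℝ) / v n) atTop (𝓝 l) := by
  have hbd : ∀ n : ℕ, BddBelow {x : ℤ | (-(n : ℤ), x) ∈ forwardCluster ω 0} :=
    fun n => ⟨0, fun x hx => nonneg_of_mem hx⟩
  have hex : ∀ n : ℕ, ∃ v : ℕ, IsLeast {x : ℤ | (-(n : ℤ), x) ∈ forwardCluster ω 0} (v : ℤ) := by
    intro n
    have hmem := Int.csInf_mem ⟨_, (hw n).1⟩ (hbd n)
    obtain ⟨v, hv⟩ := Int.eq_ofNat_of_zero_le (nonneg_of_mem hmem)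
    exact ⟨v, hv ▸ hmem, fun x hx => hv ▸ csInf_le (hbd n) hx⟩
  choose v hv using hex
  have hle : ∀ n : ℕ, (n : ℤ) ≤ a (v n) := fun n => (ha (v n)).2 (hv n).1
  -- If row `v n - 1` extended to column `n` or beyond, a path there would cross column `n` strictly
  -- below `v n`.
  have hlt : ∀ n : ℕ, 0 < v n → a (v n - 1) < n := by
    intro n hn
    by_contra hcon
    obtain ⟨y, hy, hy'⟩ := exists_mem_column (ha (v n - 1)).1 (not_lt.1 hcon)
    have := (hv n).2 hy'
    lia
  -- Each row extends only finitely far, so rows below `M` cannot reach far columns.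
  have hvt : Tendsto v atTop atTop := by
    refine tendsto_atTop.2 fun M => ?_
    filter_upwards [eventually_gt_atTop (∑ m ∈ Finset.range M, (a m).natAbs)] with n hn
    by_contra hM
    have h1 := Finset.single_le_sum (f := fun m => (a m).natAbs) (fun _ _ => Nat.zero_le _)
      (Finset.mem_range.2 (not_le.1 hM))
    have h2 := hle n
    lia
  refine ⟨v, hv, hvt, ?_⟩
  have hup : Tendsto (fun n => (a (v n) : ℝ) / v n) atTop (𝓝 l) := hal.comp hvt
  have hlo : Tendsto (fun n => (a (v n - 1) : ℝ) / v n) atTop (𝓝 l) := by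
    have h1 : Tendsto (fun m : ℕ => (a m : ℝ) / ((m + 1 : ℕ) : ℝ)) atTop (𝓝 l) := by
      have h2 := hal.mul (tendsto_natCast_div_add_atTop (𝕜 := ℝ) (1 : ℝ))
      rw [mul_one] at h2
      refine h2.congr' ?_
      filter_upwards [eventually_gt_atTop 0] with m hm
      have : (m : ℝ) ≠ 0 := by positivity
      push_cast
      field_simp
    have h2 : Tendsto (fun n => v n - 1) atTop atTop := (tendsto_sub_atTop_nat 1).comp hvt
    refine (h1.comp h2).congr' ?_
    filter_upwards [hvt.eventually_gt_atTop 0] with n hn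
    simp only [Function.comp, Nat.sub_add_cancel hn]
  refine tendsto_of_tendsto_of_tendsto_of_le_of_le' hlo hup ?_ ?_
  · filter_upwards [hvt.eventually_gt_atTop 0] with n hn
    refine div_le_div_of_nonneg_right ?_ (by positivity)
    exact_mod_cast (hlt n hn).le
  · refine Eventually.of_forall fun n => div_le_div_of_nonneg_right ?_ (by positivity)
    exact_mod_cast hle n

/-- On percolation, both boundaries have slopes, inverse to each other. -/
theorem boundary_slopes {p : unitInterval} (hp0 : 0 < p) (hp1 : p < 1) {l : ℝ}
    (hl : ∀ᵐ η ∂percLaw p, Surv η → Tendsto (fun n : ℕ => (top η n : ℝ) / n) atTop (𝓝 l)) :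
    ∀ᵐ ω ∂law p, (forwardCluster ω 0).Infinite → ∃ w : ℕ → ℤ, ∃ v : ℕ → ℕ,
      (∀ n : ℕ, IsGreatest {x : ℤ | (-(n : ℤ), x) ∈ forwardCluster ω 0} (w n)) ∧
      (∀ n : ℕ, IsLeast {x : ℤ | (-(n : ℤ), x) ∈ forwardCluster ω 0} (v n)) ∧
      Tendsto v atTop atTop ∧
      Tendsto (fun n : ℕ => (w n : ℝ) / n) atTop (𝓝 l) ∧
      Tendsto (fun n : ℕ => (n : ℝ) / v n) atTop (𝓝 l) := by
  have h := exists_isGreatest_column hp0 hp1 hl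
  filter_upwards [h, (measurePreserving_flip p).quasiMeasurePreserving.ae h] with ω h1 h2 hinf
  obtain ⟨w, hw, hwl⟩ := h1 hinf
  obtain ⟨a, ha, hal⟩ := h2 (infinite_forwardCluster_flip hinf)
  have ha' : ∀ m : ℕ, IsGreatest {x : ℤ | (-x, (m : ℤ)) ∈ forwardCluster ω 0} (a m) := by
    intro m
    have hset : {x : ℤ | (-(m : ℤ), x) ∈ forwardCluster (fun z => ω (flip z)) 0} =
        {x : ℤ | (-x, (m : ℤ)) ∈ forwardCluster ω 0} := by
      ext x
      exact mem_forwardCluster_flip.trans (by simp [flip])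
    exact hset ▸ ha m
  obtain ⟨v, hv, hvt, hvl⟩ := exists_isLeast_column hw ha' hal
  exact ⟨w, v, hw, hv, hvt, hwl, hvl⟩

lemma percProb_le_surv {q : unitInterval} (hq0 : 0 < q) (hq1 : q < 1) :
    percProb q ≤ percLaw q {ω | Surv ω} := by
  rw [← (measurePreserving_toEnv q).measure_preimage measurableSet_surv.nullMeasurableSet]
  refine measure_mono_ae ?_
  filter_upwards [(measurePreserving_toEnv q).quasiMeasurePreserving.ae (ae_good hq0 hq1)]
    with ω hg hinf
  exact hg.surv_of_infinite hinf

/-- Ensures that a percolating density is positive, as the almost sure properties of environments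
require. -/
lemma percProb_zero : percProb 0 = 0 := by
  have hfin : (forwardCluster (fun _ => false) 0).Finite := by
    refine (Set.finite_singleton 0).subset fun z hz => ?_
    induction hz with
    | refl => rfl
    | tail _ h _ => exact absurd h.1 (by simp)
  rw [percProb, law]
  simp only [bernoulliMeasure_zero]
  rw [Measure.infinitePi_dirac, Measure.dirac_apply]
  exact Set.indicator_of_notMem (s := {ω | (forwardCluster ω 0).Infinite}) (fun h => h hfin) _

/-- In the supercritical phase the slope of the upper boundary is at least one. -/
lemma one_le_slope {q : unitInterval} (hq0 : 0 < q) (hq1 : q < 1) (hperc : 0 < percProb q) {l : ℝ}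
    (hl0 : 0 ≤ l)
    (hl : ∀ᵐ η ∂percLaw q, Surv η → Tendsto (fun n : ℕ => (top η n : ℝ) / n) atTop (𝓝 l)) :
    1 ≤ l := by
  have hne : ∃ᵐ ω ∂law q, (forwardCluster ω 0).Infinite := by
    intro h
    rw [ae_iff] at h
    simp only [not_not] at h
    exact hperc.ne' h
  obtain ⟨ω, hinf, h⟩ := (hne.and_eventually (boundary_slopes hq0 hq1 hl)).exists
  obtain ⟨w, v, hw, hv, hvt, hwl, hvl⟩ := h hinf
  -- The product of `n / v n` and `w n / n` is `w n / v n`, at least 1 because the lowest point of a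
  -- column is not above its highest.
  have h1 : 1 ≤ l * l := by
    refine ge_of_tendsto (hvl.mul hwl) ?_
    filter_upwards [eventually_gt_atTop 0, hvt.eventually_gt_atTop 0] with n hn hvn
    have hn' : (n : ℝ) ≠ 0 := by positivity
    have hvn' : (0 : ℝ) < v n := by positivity
    rw [mul_comm, div_mul_div_cancel₀ hn', le_div_iff₀ hvn', one_mul]
    exact_mod_cast (hw n).2 (hv n).1
  nlinarith

lemma upper_eq {n : ℕ} {w : ℤ}
    (h : IsGreatest {x : ℤ | (-(n : ℤ), x) ∈ forwardCluster ω 0} w) :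
    upper ω n = ((w : ℝ) : EReal) :=
  le_antisymm (iSup₂_le fun _ hx => EReal.coe_le_coe_iff.2 (Int.cast_le.2 (h.2 hx)))
    (le_iSup₂_of_le w h.1 le_rfl)

lemma lower_eq {n : ℕ} {v : ℤ}
    (h : IsLeast {x : ℤ | (-(n : ℤ), x) ∈ forwardCluster ω 0} v) :
    lower ω n = ((v : ℝ) : EReal) :=
  le_antisymm (iInf₂_le_of_le v h.1 le_rfl)
    (le_iInf₂ fun _ hx => EReal.coe_le_coe_iff.2 (Int.cast_le.2 (h.2 hx)))

end Cluster

end OTSP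

theorem proposition1 (p : unitInterval) (hpc : OTSP.criticalValue < p) (hp1 : p < 1) :
    ∃ ρ : ℝ, ρ < -1 ∧
      ∀ᵐ ω ∂(OTSP.law p), (OTSP.forwardCluster ω 0).Infinite →
        Tendsto (fun n : ℕ => OTSP.upper ω n / (-((n : ℝ) : EReal))) atTop (𝓝 (ρ : EReal)) ∧
        Tendsto (fun n : ℕ => OTSP.lower ω n / (-((n : ℝ) : EReal))) atTop
          (𝓝 ((1 / ρ : ℝ) : EReal)) := by
  -- An intermediate percolating density: its slope is at least 1, and passing to `p` adds at least
  -- `p - q > 0`.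
  obtain ⟨q, hq, hqp⟩ := sInf_lt_iff.1 hpc
  have hperc : 0 < OTSP.percProb q := hq
  have hq0 : 0 < q := by
    rcases (unitInterval.nonneg' (t := q)).eq_or_lt with h | h
    · rw [← h, OTSP.percProb_zero] at hperc
      exact absurd hperc (lt_irrefl _)
    · exact h
  have hq1 := hqp.trans hp1
  have hp0 := hq0.trans hqp
  have hθ : OTSP.percLaw q {ω | OTSP.Surv ω} ≠ 0 :=
    (hperc.trans_le (OTSP.percProb_le_surv hq0 hq1)).ne'
  have hθ' : OTSP.percLaw p {ω | OTSP.Surv ω} ≠ 0 :=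
    (hperc.trans_le ((OTSP.percProb_le_surv hq0 hq1).trans (OTSP.percLaw_surv_mono hqp.le))).ne'
  obtain ⟨l, hl0, hl⟩ := OTSP.exists_slope hq0 hq1 hθ
  obtain ⟨l', -, hl'⟩ := OTSP.exists_slope hp0 hp1 hθ'
  have h1 := OTSP.one_le_slope hq0 hq1 hperc hl0 hl
  have h2 := OTSP.slope_add_le hq0 hqp.le hp1 hθ hl hl'
  have hqp' : (q : ℝ) < p := hqp
  have hl1 : 1 < l' := by linarith
  refine ⟨-l', by linarith, ?_⟩
  filter_upwards [OTSP.boundary_slopes hp0 hp1 hl'] with ω hω hinf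
  obtain ⟨w, v, hw, hv, -, hwl, hvl⟩ := hω hinf
  constructor
  · refine (((continuous_coe_real_ereal.tendsto _).comp hwl.neg)).congr fun n => ?_
    rw [OTSP.upper_eq (hw n), ← EReal.coe_neg, ← EReal.coe_div, Function.comp, div_neg]
  · have h3 : Tendsto (fun n : ℕ => -((n : ℝ) / v n)⁻¹) atTop (𝓝 (1 / -l')) := by
      rw [one_div, inv_neg]
      exact (hvl.inv₀ (by linarith)).neg
    refine (((continuous_coe_real_ereal.tendsto _).comp h3)).congr fun n => ?_
    rw [OTSP.lower_eq (hv n), ← EReal.coe_neg, ← EReal.coe_div, Function.comp, div_neg, inv_div]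
    simp
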